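/- **Proposition A.1.** Let $n\ge 1$, $0<\sigma<\alpha<1$, $1<p<\infty$ and $\frac{\sigma}{\alpha}<s<1$. Let $p_1\in(0,\infty]$ and $p_2\in(0,\infty)$ satisfy $$\frac1p=\frac1{p_1}+\frac1{p_2},\qquad \Bigl(1-\frac{\sigma}{\alpha s}\Bigr)p_1>1,\qquad \frac{\sigma}{s}\,p_2>1 .$$ Then there is a constant $C$, depending only on $n,\alpha,\sigma,s,p,p_1,p_2$, such that the following holds. Let $F:\mathbb C\to\mathbb C$ be Hölder continuous of order $\alpha$ with constant $K$, i.e. $|F(z)-F(w)|\le K|z-w|^\alpha$ for all $z,w\in\mathbb C$. Let $u:\mathbb R^n\to\mathbb C$ satisfy $|u|^{\alpha-\sigma/s}\in L^{p_1}(\mathbb R^n)$ and $|\nabla|^s u\in L^{\sigma p_2/s}(\mathbb R^n)$. Then $|\nabla|^\sigma F(u)\in L^p(\mathbb R^n)$ and $$\bigl\||\nabla|^\sigma F(u)\bigr\|_{L^p}\le C\,K\,\bigl\||u|^{\alpha-\frac{\sigma}{s}}\bigr\|_{L^{p_1}}\,\bigl\||\nabla|^s u\bigr\|_{L^{\sigma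 p_2/s}}^{\sigma/s}.$$ Here, for a Schwartz function $\varphi$ and $t>0$, $\widehat{|\nabla|^t\varphi}(\xi)=|\xi|^t\hat\varphi(\xi)$ with $\hat\varphi(\xi)=\int_{\mathbb R^n}e^{-2\pi i x\cdot\xi}\varphi(x)\,dx$. For a measurable function $f$ with $\int_{\mathbb R^n}|f(x)|(1+|x|)^{-n-t}\,dx<\infty$ (in particular for every $f\in L^r(\mathbb R^n)$, $1\le r\le\infty$), $|\nabla|^t f=g$ means $\int f\,|\nabla|^t\varphi\,dx=\int g\,\varphi\,dx$ for all Schwartz functions $\varphi$; the hypothesis on $|\nabla|^s u$ includes that $u$ is such a function with $t=s$, and the conclusion includes that $F(u)$ is such a function with $t=\sigma$. -/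

import Mathlib

open MeasureTheory
open scoped ENNReal NNReal FourierTransform SchwartzMap

/-- Fractional differentiation `|∇|^s φ` of a Schwartz function `φ` on `ℝⁿ`, defined on the Fourier
side as multiplication by `|ξ|^s`, where `φ̂(ξ) = ∫ e^{-2πi x·ξ} φ(x) dx`. -/
noncomputable def fracDerivSchwartz {n : ℕ} (s : ℝ) (φ : 𝓢(EuclideanSpace ℝ (Fin n), ℂ)) :
    EuclideanSpace ℝ (Fin n) → ℂ :=
  𝓕⁻ (fun ξ : EuclideanSpace ℝ (Fin n) =>
    ((‖ξ‖ ^ s : ℝ) : ℂ) * 𝓕 (φ : EuclideanSpace ℝ (Fin n) → ℂ) ξ)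

/-- `HasFracDeriv s u g` says that `|∇|^s u = g` (for `s > 0`), in the sense of distributions on
`ℝⁿ`: `⟨u, |∇|^s φ⟩ = ⟨g, φ⟩` for all Schwartz functions `φ`. Since `|∇|^s φ` is continuous and
`O((1 + |x|)^{-n-s})` but in general not Schwartz, the pairing on the left is defined for those `u`
that are integrable against the weight `(1 + |x|)^{-n-s}`; this includes every `u` in `L^r(ℝⁿ)`,
`1 ≤ r ≤ ∞`. -/
def HasFracDeriv {n : ℕ} (s : ℝ) (u g : EuclideanSpace ℝ (Fin n) → ℂ) : Prop :=
  Integrable (fun x : EuclideanSpace ℝ (Fin n) =>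
    (((1 + ‖x‖) ^ (-((n : ℝ) + s)) : ℝ) : ℂ) * u x) volume ∧
  ∀ φ : 𝓢(EuclideanSpace ℝ (Fin n), ℂ),
    Integrable (fun x => g x * φ x) volume ∧
    ∫ x, u x * fracDerivSchwartz s φ x = ∫ x, g x * φ x

/-!
The increments of `u` are controlled by the maximal function `M g` of its fractional derivative `g`:
`u` is the limit of its averages against a mollifier at dyadic scales, and the difference of two
consecutive averages is `g` tested against a rapidly decaying kernel, whence
`|u x - u y| ≤ C |x - y|^s (M g x + M g y)` at all Lebesgue points.

On the other hand, `|∇|^σ f` is a multiple of the singular integral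
`x ↦ ∫ (f (x + y) - f x) |y|^(-n-σ) dy`. For `f = F ∘ u` the increments are at most
`K |u (x + y) - u x|^α`. Inserting the bound above for `|y| ≤ A` and the trivial bound by values of
`|u|^α` for `|y| > A`, and optimizing in `A`, one obtains
`| |∇|^σ F(u) | ≤ C K G^a U^(1 - a)` with `a = σ / (α s)`, where `G` and `U` are the sums of
`(M g)^α` and `|u|^α` with their own maximal functions. The maximal theorem and Hölder's inequality
conclude.
-/

open Set Metric Module Filter Topology

section LayerCake

lemma setLIntegral_Ioi_zero_rpow_eq_top (r : ℝ) :
    ∫⁻ t in Ioi (0 : ℝ), ENNReal.ofReal (t ^ r) = ∞ := by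
  by_contra h
  refine not_integrableOn_Ioi_rpow r ⟨by fun_prop, ?_⟩
  rw [hasFiniteIntegral_iff_ofReal]
  · exact lt_top_iff_ne_top.2 h
  · filter_upwards [ae_restrict_mem measurableSet_Ioi] with t ht using Real.rpow_nonneg ht.le r

lemma setLIntegral_Ioi_rpow_eq {a c : ℝ} (ha : 0 < a) (hc : 0 < c) :
    ∫⁻ t in Ioi a, ENNReal.ofReal (c * t ^ (-c - 1)) = ENNReal.ofReal (a ^ (-c)) := by
  rw [← ofReal_integral_eq_lintegral_ofReal
    ((integrableOn_Ioi_rpow_of_lt (by linarith) ha).const_mul c)]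
  · rw [integral_const_mul, integral_Ioi_rpow_of_lt (by linarith) ha, sub_add_cancel]
    congr 1
    field_simp
  · filter_upwards [ae_restrict_mem measurableSet_Ioi] with t ht
    have : 0 < t := ha.trans ht
    positivity

variable {X : Type*} [MeasurableSpace X] {μ : Measure X} {f : X → ℝ≥0∞} {p : ℝ}

lemma lintegral_rpow_eq_lintegral_meas_ofReal_lt_mul (hf : AEMeasurable f μ) (hp : 0 < p) :
    ∫⁻ x, f x ^ p ∂μ = ENNReal.ofReal p *
      ∫⁻ t in Ioi (0 : ℝ), μ {x | ENNReal.ofReal t < f x} * ENNReal.ofReal (t ^ (p - 1)) := by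
  by_cases hfin : ∀ᵐ x ∂μ, f x ≠ ∞
  · have hrpow : ∫⁻ x, f x ^ p ∂μ = ∫⁻ x, ENNReal.ofReal ((f x).toReal ^ p) ∂μ := by
      refine lintegral_congr_ae (hfin.mono fun x hx => ?_)
      simp only [← ENNReal.ofReal_rpow_of_nonneg ENNReal.toReal_nonneg hp.le,
        ENNReal.ofReal_toReal hx]
    rw [hrpow, lintegral_rpow_eq_lintegral_meas_lt_mul μ
      (Eventually.of_forall fun x => ENNReal.toReal_nonneg) hf.ennreal_toReal hp]
    congr 1
    refine setLIntegral_congr_fun measurableSet_Ioi fun t ht => ?_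
    congr 1
    refine measure_congr (hfin.mono fun x hx => propext ?_)
    exact (ENNReal.ofReal_lt_iff_lt_toReal (le_of_lt ht) hx).symm
  · have hpos : μ {x | f x = ∞} ≠ 0 := by simpa [ae_iff] using hfin
    have hleft : ∫⁻ x, f x ^ p ∂μ = ∞ := by
      by_contra h
      refine hfin ((ae_lt_top' (hf.pow_const p) h).mono fun x hx htop => ?_)
      simp [htop, hp] at hx
    have hright : ∞ ≤ ∫⁻ t in Ioi (0 : ℝ),
        μ {x | ENNReal.ofReal t < f x} * ENNReal.ofReal (t ^ (p - 1)) := by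
      calc ∞ = ∫⁻ t in Ioi (0 : ℝ), μ {x | f x = ∞} * ENNReal.ofReal (t ^ (p - 1)) := by
            rw [lintegral_const_mul _ (by fun_prop), setLIntegral_Ioi_zero_rpow_eq_top,
              ENNReal.mul_top hpos]
        _ ≤ _ := by
            gcongr with t x
            rintro hx
            exact hx ▸ ENNReal.ofReal_lt_top
    rw [hleft, top_le_iff.1 hright, ENNReal.mul_top (by simpa using hp)]

end LayerCake

section MaximalFunction

variable {X : Type*} [PseudoMetricSpace X] [MeasurableSpace X] {μ : Measure X}
  {f g : X → ℝ≥0∞} {c : ℝ≥0∞} {x : X}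

variable (μ) in
/-- The centred Hardy–Littlewood maximal function. Only balls of dyadic radius are used, so that the
supremum is countable; on a doubling space this changes it by a bounded factor. -/
noncomputable def maximalFn (f : X → ℝ≥0∞) (x : X) : ℝ≥0∞ :=
  ⨆ k : ℤ, (∫⁻ z in closedBall x ((2 : ℝ) ^ k), f z ∂μ) / μ (closedBall x ((2 : ℝ) ^ k))

lemma measurable_measure_closedBall [BorelSpace X] [SecondCountableTopology X] [SFinite μ] (r : ℝ) :
    Measurable fun x => μ (closedBall x r) := by
  refine measurable_measure_prodMk_left (s := {p : X × X | dist p.2 p.1 ≤ r}) ?_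
  exact measurableSet_le (by fun_prop) measurable_const

lemma measurable_maximalFn [BorelSpace X] [SecondCountableTopology X] [SFinite μ] :
    Measurable (maximalFn μ f) := by
  refine Measurable.iSup fun k => Measurable.div ?_ (measurable_measure_closedBall _)
  simpa only [withDensity_apply _ isClosed_closedBall.measurableSet]
    using measurable_measure_closedBall (μ := μ.withDensity f) ((2 : ℝ) ^ k)

lemma maximalFn_const_mul (hc : c ≠ ∞) (f : X → ℝ≥0∞) (x : X) :
    maximalFn μ (fun z => c * f z) x = c * maximalFn μ f x := by
  simp only [maximalFn, ENNReal.mul_iSup, lintegral_const_mul' c _ hc, mul_div_assoc]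

variable [ProperSpace X] [IsFiniteMeasureOnCompacts μ] [μ.IsOpenPosMeasure]

lemma maximalFn_le_iff : maximalFn μ f x ≤ c ↔
    ∀ k : ℤ, ∫⁻ z in closedBall x ((2 : ℝ) ^ k), f z ∂μ ≤ c * μ (closedBall x ((2 : ℝ) ^ k)) := by
  refine iSup_le_iff.trans (forall_congr' fun k => ?_)
  exact ENNReal.div_le_iff (measure_closedBall_pos μ x (by positivity)).ne'
    measure_closedBall_lt_top.ne

lemma setLIntegral_closedBall_le_maximalFn_mul (f : X → ℝ≥0∞) (x : X) (k : ℤ) :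
    ∫⁻ z in closedBall x ((2 : ℝ) ^ k), f z ∂μ ≤
      maximalFn μ f x * μ (closedBall x ((2 : ℝ) ^ k)) :=
  maximalFn_le_iff.1 le_rfl k

lemma exists_mul_measure_closedBall_lt_of_lt_maximalFn (h : c < maximalFn μ f x) :
    ∃ k : ℤ, c * μ (closedBall x ((2 : ℝ) ^ k)) < ∫⁻ z in closedBall x ((2 : ℝ) ^ k), f z ∂μ := by
  contrapose! h
  exact maximalFn_le_iff.2 h

lemma maximalFn_le_add_const (h : ∀ z, f z ≤ g z + c) :
    maximalFn μ f x ≤ maximalFn μ g x + c := by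
  refine maximalFn_le_iff.2 fun k => ?_
  calc ∫⁻ z in closedBall x ((2 : ℝ) ^ k), f z ∂μ
      ≤ ∫⁻ z in closedBall x ((2 : ℝ) ^ k), (g z + c) ∂μ := lintegral_mono h
    _ = (∫⁻ z in closedBall x ((2 : ℝ) ^ k), g z ∂μ) + c * μ (closedBall x ((2 : ℝ) ^ k)) := by
        rw [lintegral_add_right _ measurable_const, setLIntegral_const]
    _ ≤ (maximalFn μ g x + c) * μ (closedBall x ((2 : ℝ) ^ k)) := by
        rw [add_mul]
        gcongr
        exact setLIntegral_closedBall_le_maximalFn_mul g x k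

lemma maximalFn_le_of_ae_le (h : ∀ᵐ z ∂μ, f z ≤ c) (x : X) : maximalFn μ f x ≤ c := by
  refine maximalFn_le_iff.2 fun k => ?_
  rw [← setLIntegral_const]
  exact lintegral_mono_ae (ae_restrict_of_ae h)

end MaximalFunction

section MaximalTheorem

variable {E : Type*} [NormedAddCommGroup E] [NormedSpace ℝ E] [FiniteDimensional ℝ E]
  [MeasurableSpace E] [BorelSpace E] {μ : Measure E} [μ.IsAddHaarMeasure]

lemma setLIntegral_closedBall_le_maximalFn (f : E → ℝ≥0∞) (x : E) {r : ℝ} (hr : 0 < r) :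
    ∫⁻ z in closedBall x r, f z ∂μ ≤
      ENNReal.ofReal ((2 * r) ^ finrank ℝ E) * μ (ball 0 1) * maximalFn μ f x := by
  obtain ⟨k, hkr, hrk⟩ := exists_mem_Ioc_zpow hr (one_lt_two : (1 : ℝ) < 2)
  have hk : (2 : ℝ) ^ (k + 1) ≤ 2 * r := by
    rw [zpow_add_one₀ two_ne_zero, mul_comm]; linarith
  calc ∫⁻ z in closedBall x r, f z ∂μ
      ≤ ∫⁻ z in closedBall x ((2 : ℝ) ^ (k + 1)), f z ∂μ :=
        lintegral_mono_set (closedBall_subset_closedBall hrk)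
    _ ≤ maximalFn μ f x * μ (closedBall x ((2 : ℝ) ^ (k + 1))) :=
        setLIntegral_closedBall_le_maximalFn_mul f x _
    _ ≤ maximalFn μ f x * μ (closedBall x (2 * r)) := by gcongr
    _ = _ := by rw [Measure.addHaar_closedBall μ x (by positivity), mul_comm]

-- Vitali: a disjoint subfamily of the balls, enlarged five times, covers their union.
lemma mul_measure_biUnion_closedBall_le {ι : Type*} (S : Set ι) {c : ι → E} {r : ι → ℝ} {R : ℝ}
    (hr : ∀ i ∈ S, 0 < r i) (hR : ∀ i ∈ S, r i ≤ R) {ν : Measure E} {t : ℝ≥0∞}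
    (hν : ∀ i ∈ S, t * μ (closedBall (c i) (r i)) ≤ ν (closedBall (c i) (r i))) :
    t * μ (⋃ i ∈ S, closedBall (c i) (r i)) ≤ ENNReal.ofReal (5 ^ finrank ℝ E) * ν univ := by
  obtain ⟨u, huS, hdisj, hcov⟩ := Vitali.exists_disjoint_subfamily_covering_enlargement_closedBall
    S c r R hR 5 (by norm_num)
  have hcount : u.Countable := hdisj.countable_of_nonempty_interior fun i hi =>
    ⟨c i, ball_subset_interior_closedBall (mem_ball_self (hr i (huS hi)))⟩
  have hsub : ⋃ i ∈ S, closedBall (c i) (r i) ⊆ ⋃ i ∈ u, closedBall (c i) (5 * r i) :=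
    iUnion₂_subset fun i hi =>
      let ⟨_, hj, hij⟩ := hcov i hi
      hij.trans (subset_biUnion_of_mem (u := fun i => closedBall (c i) (5 * r i)) hj)
  calc t * μ (⋃ i ∈ S, closedBall (c i) (r i))
      ≤ t * ∑' i : u, μ (closedBall (c i) (5 * r i)) := by
        gcongr
        exact (measure_mono hsub).trans (measure_biUnion_le μ hcount _)
    _ = ENNReal.ofReal (5 ^ finrank ℝ E) * ∑' i : u, t * μ (closedBall (c i) (r i)) := by
        rw [ENNReal.tsum_mul_left, mul_left_comm, ← ENNReal.tsum_mul_left (a := ENNReal.ofReal _)]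
        congr 2 with i
        rw [Measure.addHaar_closedBall_mul μ _ (by norm_num) (hr i (huS i.2)).le,
          Measure.addHaar_closedBall_center μ (c i)]
    _ ≤ ENNReal.ofReal (5 ^ finrank ℝ E) * ∑' i : u, ν (closedBall (c i) (r i)) := by
        gcongr with i
        exact hν i (huS i.2)
    _ ≤ _ := by
        rw [← measure_biUnion hcount hdisj fun i _ => isClosed_closedBall.measurableSet]
        gcongr
        exact subset_univ _

variable [Nontrivial E]

lemma mul_measure_lt_maximalFn_le (f : E → ℝ≥0∞) {t : ℝ≥0∞} (ht₀ : t ≠ 0) (ht : t ≠ ∞) :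
    t * μ {x | t < maximalFn μ f x} ≤ ENNReal.ofReal (5 ^ finrank ℝ E) * ∫⁻ z, f z ∂μ := by
  by_cases hI : ∫⁻ z, f z ∂μ = ∞
  · simp [hI, ENNReal.mul_top]
  set S : Set (E × ℤ) := {a | t * μ (closedBall a.1 ((2 : ℝ) ^ a.2)) ≤
    μ.withDensity f (closedBall a.1 ((2 : ℝ) ^ a.2))}
  have hunit : t * μ (ball (0 : E) 1) ≠ 0 := mul_ne_zero ht₀ (measure_ball_pos μ 0 one_pos).ne'
  have hradius : ∀ a ∈ S, (2 : ℝ) ^ a.2 ≤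
      max 1 ((∫⁻ z, f z ∂μ) / (t * μ (ball (0 : E) 1))).toReal := by
    intro a ha
    have hmass : t * μ (closedBall a.1 ((2 : ℝ) ^ a.2)) ≤ ∫⁻ z, f z ∂μ := by
      simpa using le_trans ha (measure_mono (subset_univ _))
    rw [Measure.addHaar_closedBall μ a.1 (by positivity), mul_left_comm,
      ← ENNReal.le_div_iff_mul_le (Or.inl hunit)
        (Or.inl (ENNReal.mul_ne_top ht measure_ball_lt_top.ne)),
      ENNReal.ofReal_le_iff_le_toReal (ENNReal.div_ne_top hI hunit)] at hmass
    rcases le_total ((2 : ℝ) ^ a.2) 1 with h | h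
    · exact le_max_of_le_left h
    · exact le_max_of_le_right ((le_self_pow₀ h finrank_pos.ne').trans hmass)
  have hcover : {x | t < maximalFn μ f x} ⊆ ⋃ a ∈ S, closedBall a.1 ((2 : ℝ) ^ a.2) := by
    intro x hx
    obtain ⟨k, hk⟩ := exists_mul_measure_closedBall_lt_of_lt_maximalFn hx
    refine mem_biUnion (x := (x, k)) ?_ (mem_closedBall_self (by positivity))
    simpa [S, withDensity_apply _ isClosed_closedBall.measurableSet] using hk.le
  calc t * μ {x | t < maximalFn μ f x}
      ≤ t * μ (⋃ a ∈ S, closedBall a.1 ((2 : ℝ) ^ a.2)) := by gcongr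
    _ ≤ ENNReal.ofReal (5 ^ finrank ℝ E) * μ.withDensity f univ :=
        mul_measure_biUnion_closedBall_le S (fun a _ => by positivity) hradius fun _ ha => ha
    _ = _ := by simp

lemma mul_measure_two_mul_lt_maximalFn_le (f : E → ℝ≥0∞) {t : ℝ≥0∞} (ht₀ : t ≠ 0) (ht : t ≠ ∞) :
    t * μ {x | 2 * t < maximalFn μ f x} ≤
      ENNReal.ofReal (5 ^ finrank ℝ E) * ∫⁻ z in {z | t < f z}, f z ∂μ := by
  have htrunc : ∀ z, f z ≤ indicator {z | t < f z} f z + t := by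
    intro z
    by_cases hz : t < f z
    · simp [hz]
    · simp [hz, not_lt.1 hz]
  calc t * μ {x | 2 * t < maximalFn μ f x}
      ≤ t * μ {x | t < maximalFn μ (indicator {z | t < f z} f) x} := by
        refine mul_le_mul_right (measure_mono fun x hx => lt_of_add_lt_add_right (a := t) ?_) t
        exact (two_mul t ▸ hx).trans_le (maximalFn_le_add_const htrunc)
    _ ≤ ENNReal.ofReal (5 ^ finrank ℝ E) * ∫⁻ z, indicator {z | t < f z} f z ∂μ :=
        mul_measure_lt_maximalFn_le _ ht₀ ht
    _ ≤ _ := mul_le_mul_right (lintegral_indicator_le _ _) _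

-- Both sides are rewritten by the layer cake formula, the right one for the measure `f μ` and the
-- exponent `q - 1`, and the integrands are compared by the truncated weak type bound.
lemma lintegral_maximalFn_div_two_rpow_le {q : ℝ} (hq : 1 < q) {f : E → ℝ≥0∞}
    (hf : AEMeasurable f μ) :
    ∫⁻ x, (maximalFn μ f x / 2) ^ q ∂μ ≤
      ENNReal.ofReal (q * 5 ^ finrank ℝ E / (q - 1)) * ∫⁻ x, f x ^ q ∂μ := by
  have hq' : 0 < q - 1 := sub_pos.2 hq
  have hfq : ∫⁻ x, f x ^ q ∂μ = ∫⁻ x, f x ^ (q - 1) ∂(μ.withDensity f) := by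
    rw [lintegral_withDensity_eq_lintegral_mul₀ hf (hf.pow_const _)]
    refine lintegral_congr fun x => ?_
    conv_rhs => rw [Pi.mul_apply, ← ENNReal.rpow_one (f x), ← ENNReal.rpow_mul, one_mul]
    rw [← ENNReal.rpow_add_of_nonneg _ _ zero_le_one hq'.le, add_sub_cancel]
  rw [hfq, lintegral_rpow_eq_lintegral_meas_ofReal_lt_mul
      (measurable_maximalFn.div_const 2).aemeasurable (by linarith),
    lintegral_rpow_eq_lintegral_meas_ofReal_lt_mul
      (hf.mono_ac (withDensity_absolutelyContinuous μ f)) hq',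
    ← mul_assoc, ← ENNReal.ofReal_mul (by positivity), div_mul_cancel₀ _ hq'.ne',
    ENNReal.ofReal_mul (by linarith), mul_assoc]
  gcongr
  rw [← lintegral_const_mul' _ _ ENNReal.ofReal_ne_top]
  refine setLIntegral_mono' measurableSet_Ioi fun t (ht : 0 < t) => ?_
  have hlevel : {x | ENNReal.ofReal t < maximalFn μ f x / 2} =
      {x | 2 * ENNReal.ofReal t < maximalFn μ f x} := by
    ext x
    rw [mem_ofPred_eq, ENNReal.lt_div_iff_mul_lt (by simp) (by simp), mul_comm, mem_ofPred_eq]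
  have hpow : ENNReal.ofReal (t ^ (q - 1)) =
      ENNReal.ofReal t * ENNReal.ofReal (t ^ (q - 1 - 1)) := by
    rw [← ENNReal.ofReal_mul ht.le, mul_comm, ← Real.rpow_add_one ht.ne', sub_add_cancel]
  rw [hlevel, withDensity_apply', hpow, mul_left_comm, ← mul_assoc, ← mul_assoc]
  refine mul_le_mul_left ?_ _
  exact mul_measure_two_mul_lt_maximalFn_le f (by simpa using ht) ENNReal.ofReal_ne_top

lemma lintegral_maximalFn_rpow_le {q : ℝ} (hq : 1 < q) {f : E → ℝ≥0∞} (hf : AEMeasurable f μ) :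
    ∫⁻ x, maximalFn μ f x ^ q ∂μ ≤
      ENNReal.ofReal (2 ^ q * (q * 5 ^ finrank ℝ E / (q - 1))) * ∫⁻ x, f x ^ q ∂μ := by
  have hq₀ : 0 < q := by linarith
  calc ∫⁻ x, maximalFn μ f x ^ q ∂μ
      = ∫⁻ x, ENNReal.ofReal (2 ^ q) * (maximalFn μ f x / 2) ^ q ∂μ := by
        refine lintegral_congr fun x => ?_
        rw [← ENNReal.ofReal_rpow_of_pos two_pos, ENNReal.ofReal_ofNat,
          ← ENNReal.mul_rpow_of_nonneg _ _ hq₀.le,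
          ENNReal.mul_div_cancel two_ne_zero ENNReal.ofNat_ne_top]
    _ ≤ _ := by
        rw [lintegral_const_mul' _ _ ENNReal.ofReal_ne_top, ENNReal.ofReal_mul (by positivity),
          mul_assoc]
        gcongr
        exact lintegral_maximalFn_div_two_rpow_le hq hf

variable (μ) in
theorem exists_eLpNorm_maximalFn_le {q : ℝ≥0∞} (hq : 1 < q) :
    ∃ C : ℝ≥0, ∀ f : E → ℝ≥0∞, AEMeasurable f μ →
      eLpNorm (maximalFn μ f) q μ ≤ C * eLpNorm f q μ := by
  rcases eq_or_ne q ∞ with rfl | hq_top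
  · refine ⟨1, fun f _ => ?_⟩
    rw [ENNReal.coe_one, one_mul, eLpNorm_exponent_top, eLpNorm_exponent_top]
    exact eLpNormEssSup_le_of_ae_enorm_bound <| Eventually.of_forall <|
      maximalFn_le_of_ae_le (enorm_ae_le_eLpNormEssSup f μ)
  · have hq_real : 1 < q.toReal := by
      simpa using (ENNReal.toReal_lt_toReal ENNReal.one_ne_top hq_top).2 hq
    have hq₀ : q ≠ 0 := (zero_lt_one.trans hq).ne'
    refine ⟨(2 ^ q.toReal * (q.toReal * 5 ^ finrank ℝ E / (q.toReal - 1))).toNNReal ^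
      (1 / q.toReal), fun f hf => ?_⟩
    rw [eLpNorm_eq_lintegral_rpow_enorm_toReal hq₀ hq_top,
      eLpNorm_eq_lintegral_rpow_enorm_toReal hq₀ hq_top,
      ENNReal.coe_rpow_of_nonneg _ (by positivity),
      ← ENNReal.mul_rpow_of_nonneg _ _ (by positivity)]
    gcongr
    exact lintegral_maximalFn_rpow_le hq_real hf

end MaximalTheorem

section RadialKernels

lemma setLIntegral_Ioc_zero_rpow_eq {a c : ℝ} (ha : 0 ≤ a) (hc : 0 < c) :
    ∫⁻ t in Ioc 0 a, ENNReal.ofReal (c * t ^ (c - 1)) = ENNReal.ofReal (a ^ c) := by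
  rw [← ofReal_integral_eq_lintegral_ofReal, ← intervalIntegral.integral_of_le ha,
    intervalIntegral.integral_const_mul, integral_rpow (Or.inl (by linarith)), sub_add_cancel,
    Real.zero_rpow hc.ne', sub_zero, mul_div_cancel₀ _ hc.ne']
  · rw [← IntegrableOn, ← intervalIntegrable_iff_integrableOn_Ioc_of_le ha]
    exact (intervalIntegral.intervalIntegrable_rpow' (by linarith)).const_mul c
  · filter_upwards [ae_restrict_mem measurableSet_Ioc] with t ht
    have : 0 < t := ht.1
    positivity

lemma ofReal_rpow_le_setLIntegral_max {ρ A d β : ℝ} (hρ : 0 < ρ) (hρA : ρ ≤ A) (hβ : 0 < β) :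
    ENNReal.ofReal (ρ ^ (-(d - β))) ≤
      ∫⁻ t in Ioc 0 A, ENNReal.ofReal ((β + 1) * t ^ β * max ρ t ^ (-(d + 1))) := by
  calc ENNReal.ofReal (ρ ^ (-(d - β)))
      = ENNReal.ofReal (ρ ^ (β + 1)) * ENNReal.ofReal (ρ ^ (-(d + 1))) := by
        rw [← ENNReal.ofReal_mul (by positivity), ← Real.rpow_add hρ]
        ring_nf
    _ = ∫⁻ t in Ioc 0 ρ, ENNReal.ofReal ((β + 1) * t ^ β * max ρ t ^ (-(d + 1))) := by
        rw [← setLIntegral_Ioc_zero_rpow_eq hρ.le (by linarith), add_sub_cancel_right,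
          ← lintegral_mul_const _ (by fun_prop)]
        refine setLIntegral_congr_fun measurableSet_Ioc fun t ht => ?_
        rw [max_eq_left ht.2, ← ENNReal.ofReal_mul' (by positivity)]
    _ ≤ _ := lintegral_mono_set (Ioc_subset_Ioc_right hρA)

lemma lintegral_max_dist_rpow_neg_eq {X : Type*} [PseudoMetricSpace X] [MeasurableSpace X]
    [OpensMeasurableSpace X] [SecondCountableTopology X] (ν : Measure X) [SFinite ν] (x : X)
    {A b : ℝ} (hA : 0 < A) (hb : 0 < b) :
    ∫⁻ z, ENNReal.ofReal (max (dist z x) A ^ (-b)) ∂ν =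
      ∫⁻ r in Ioi A, ENNReal.ofReal (b * r ^ (-b - 1)) * ν (ball x r) := by
  have hmeas : MeasurableSet {p : X × ℝ | dist p.1 x < p.2} :=
    measurableSet_lt (by fun_prop) (by fun_prop)
  calc ∫⁻ z, ENNReal.ofReal (max (dist z x) A ^ (-b)) ∂ν
      = ∫⁻ z, (∫⁻ r in Ioi A, indicator {p : X × ℝ | dist p.1 x < p.2}
          (fun p => ENNReal.ofReal (b * p.2 ^ (-b - 1))) (z, r)) ∂ν := by
        refine lintegral_congr fun z => ?_
        rw [← setLIntegral_Ioi_rpow_eq (lt_max_of_lt_right hA) hb, ← Ioi_inter_Ioi,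
          ← setLIntegral_indicator measurableSet_Ioi]
        rfl
    _ = ∫⁻ r in Ioi A, ∫⁻ z, indicator {p : X × ℝ | dist p.1 x < p.2}
          (fun p => ENNReal.ofReal (b * p.2 ^ (-b - 1))) (z, r) ∂ν :=
        lintegral_lintegral_swap (Measurable.indicator (by fun_prop) hmeas).aemeasurable
    _ = _ := by
        refine lintegral_congr fun r => ?_
        rw [← setLIntegral_const, ← lintegral_indicator measurableSet_ball]
        rfl

variable {E : Type*} [NormedAddCommGroup E] [NormedSpace ℝ E] [FiniteDimensional ℝ E]
  [MeasurableSpace E] [BorelSpace E] (μ : Measure E) [μ.IsAddHaarMeasure]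

lemma exists_lintegral_mul_max_rpow_le {c : ℝ} (hc : 0 < c) :
    ∃ C : ℝ≥0, ∀ f : E → ℝ≥0∞, AEMeasurable f μ → ∀ (x : E) (A : ℝ), 0 < A →
      ∫⁻ z, f z * ENNReal.ofReal (max ‖z - x‖ A ^ (-(finrank ℝ E + c))) ∂μ ≤
        C * ENNReal.ofReal (A ^ (-c)) * maximalFn μ f x := by
  set d := finrank ℝ E
  refine ⟨(2 ^ d * ((d + c) / c)).toNNReal * (μ (ball 0 1)).toNNReal, fun f hf x A hA => ?_⟩
  have hν (r : ℝ) (hr : 0 < r) : μ.withDensity f (ball x r) ≤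
      ENNReal.ofReal ((2 * r) ^ d) * (μ (ball 0 1) * maximalFn μ f x) := by
    rw [withDensity_apply', ← mul_assoc]
    exact (lintegral_mono_set ball_subset_closedBall).trans
      (setLIntegral_closedBall_le_maximalFn f x hr)
  refine le_of_le_of_eq (b := ENNReal.ofReal (2 ^ d * ((d + c) / c)) * ENNReal.ofReal (A ^ (-c)) *
    (μ (ball 0 1) * maximalFn μ f x)) ?_ (by
      rw [ENNReal.coe_mul, ENNReal.coe_toNNReal measure_ball_lt_top.ne, ENNReal.ofReal]; ring)
  generalize μ (ball 0 1) * maximalFn μ f x = B at hν ⊢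
  calc ∫⁻ z, f z * ENNReal.ofReal (max ‖z - x‖ A ^ (-(d + c))) ∂μ
      = ∫⁻ z, ENNReal.ofReal (max (dist z x) A ^ (-(d + c))) ∂(μ.withDensity f) := by
        simp only [dist_eq_norm]
        exact (lintegral_withDensity_eq_lintegral_mul₀ hf (by fun_prop)).symm
    _ = ∫⁻ r in Ioi A, ENNReal.ofReal ((d + c) * r ^ (-(d + c) - 1)) * μ.withDensity f (ball x r) :=
        lintegral_max_dist_rpow_neg_eq _ x hA (by positivity)
    _ ≤ ∫⁻ r in Ioi A, ENNReal.ofReal (2 ^ d * ((d + c) / c)) *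
          ENNReal.ofReal (c * r ^ (-c - 1)) * B := by
        refine setLIntegral_mono' measurableSet_Ioi fun r hr => ?_
        have hr₀ : 0 < r := hA.trans hr
        refine (mul_le_mul_right (hν r hr₀) _).trans_eq ?_
        rw [← mul_assoc, ← ENNReal.ofReal_mul (by positivity), ← ENNReal.ofReal_mul (by positivity),
          show -((d : ℝ) + c) - 1 = (-c - 1) - d by ring, Real.rpow_sub_natCast hr₀.ne', mul_pow]
        congr 2
        field_simp
    _ = ENNReal.ofReal (2 ^ d * ((d + c) / c)) * ENNReal.ofReal (A ^ (-c)) * B := by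
        rw [lintegral_mul_const _ (by fun_prop), lintegral_const_mul _ (by fun_prop),
          setLIntegral_Ioi_rpow_eq hA hc]

lemma exists_lintegral_mul_rpow_mul_max_rpow_le {β : ℝ} (hβ : 0 < β) :
    ∃ C : ℝ≥0, ∀ f : E → ℝ≥0∞, AEMeasurable f μ → ∀ (x : E) (t : ℝ), 0 < t →
      ∫⁻ z, f z * ENNReal.ofReal
          ((β + 1) * t ^ β * max ‖z - x‖ t ^ (-(finrank ℝ E + 1 : ℝ))) ∂μ ≤
        C * maximalFn μ f x * ENNReal.ofReal (β * t ^ (β - 1)) := by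
  obtain ⟨C, hC⟩ := exists_lintegral_mul_max_rpow_le μ one_pos
  refine ⟨C * ((β + 1) / β).toNNReal, fun f hf x t ht => ?_⟩
  calc _ = ENNReal.ofReal ((β + 1) * t ^ β) *
        ∫⁻ z, f z * ENNReal.ofReal (max ‖z - x‖ t ^ (-(finrank ℝ E + 1 : ℝ))) ∂μ := by
        rw [← lintegral_const_mul' _ _ ENNReal.ofReal_ne_top]
        refine lintegral_congr fun z => ?_
        rw [mul_left_comm, ← ENNReal.ofReal_mul (by positivity)]
    _ ≤ ENNReal.ofReal ((β + 1) * t ^ β) *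
          (C * ENNReal.ofReal (t ^ (-1 : ℝ)) * maximalFn μ f x) := by
        gcongr
        exact hC f hf x t ht
    _ = C * (ENNReal.ofReal ((β + 1) / β) * ENNReal.ofReal (β * t ^ (β - 1))) *
          maximalFn μ f x := by
        rw [← ENNReal.ofReal_mul (by positivity), ← mul_assoc, mul_left_comm,
          ← ENNReal.ofReal_mul (by positivity), Real.rpow_sub_one ht.ne', Real.rpow_neg_one]
        congr 3
        field_simp
    _ = _ := by
        rw [ENNReal.coe_mul, ENNReal.ofReal]
        ring

-- The kernel is a superposition over `0 < t ≤ A` of the truncated kernels of the previous bound.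
lemma exists_setLIntegral_mul_norm_rpow_le [Nontrivial E] {β : ℝ} (hβ : 0 < β) :
    ∃ C : ℝ≥0, ∀ f : E → ℝ≥0∞, AEMeasurable f μ → ∀ (x : E) (A : ℝ), 0 < A →
      ∫⁻ z in closedBall x A, f z * ENNReal.ofReal (‖z - x‖ ^ (-(finrank ℝ E - β))) ∂μ ≤
        C * ENNReal.ofReal (A ^ β) * maximalFn μ f x := by
  set d := finrank ℝ E
  obtain ⟨C, hC⟩ := exists_lintegral_mul_rpow_mul_max_rpow_le μ hβ
  refine ⟨C, fun f hf x A hA => ?_⟩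
  set K : E → ℝ → ℝ≥0∞ := fun z t =>
    ENNReal.ofReal ((β + 1) * t ^ β * max ‖z - x‖ t ^ (-(d + 1 : ℝ)))
  calc ∫⁻ z in closedBall x A, f z * ENNReal.ofReal (‖z - x‖ ^ (-(d - β))) ∂μ
      ≤ ∫⁻ z in closedBall x A, f z * (∫⁻ t in Ioc 0 A, K z t) ∂μ := by
        refine setLIntegral_mono_ae' measurableSet_closedBall ?_
        filter_upwards [Measure.ae_ne μ x] with z hzx hz
        exact mul_le_mul_right (ofReal_rpow_le_setLIntegral_max
          (norm_sub_pos_iff.2 hzx) (mem_closedBall_iff_norm.1 hz) hβ) _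
    _ ≤ ∫⁻ z, (∫⁻ t in Ioc 0 A, f z * K z t) ∂μ := by
        refine (setLIntegral_le_lintegral _ _).trans_eq (lintegral_congr fun z => ?_)
        rw [lintegral_const_mul _ (by fun_prop)]
    _ = ∫⁻ t in Ioc 0 A, ∫⁻ z, f z * K z t ∂μ :=
        lintegral_lintegral_swap (hf.comp_fst.mul (by fun_prop))
    _ ≤ ∫⁻ t in Ioc 0 A, C * maximalFn μ f x * ENNReal.ofReal (β * t ^ (β - 1)) :=
        setLIntegral_mono' measurableSet_Ioc fun t ht => hC f hf x t ht.1
    _ = C * ENNReal.ofReal (A ^ β) * maximalFn μ f x := by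
        rw [lintegral_const_mul _ (by fun_prop), setLIntegral_Ioc_zero_rpow_eq hA.le hβ,
          mul_right_comm]

end RadialKernels

section PoissonMeans

lemma max_norm_sub_rpow_neg_le {E : Type*} [SeminormedAddCommGroup E] {a A : ℝ} (ha : 0 ≤ a)
    (hA : 0 < A) (x z : E) :
    max ‖z - x‖ A ^ (-a) ≤ ((1 + ‖x‖) / A + 1) ^ a * (1 + ‖z‖) ^ (-a) := by
  have hm : 0 < max ‖z - x‖ A := lt_max_of_lt_right hA
  have hz : 1 + ‖z‖ ≤ ((1 + ‖x‖) / A + 1) * max ‖z - x‖ A := by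
    calc 1 + ‖z‖ ≤ (1 + ‖x‖) / A * A + ‖z - x‖ := by
          rw [div_mul_cancel₀ _ hA.ne']
          linarith [norm_le_norm_sub_add z x]
      _ ≤ (1 + ‖x‖) / A * max ‖z - x‖ A + max ‖z - x‖ A := by
          gcongr
          exacts [le_max_right _ _, le_max_left _ _]
      _ = _ := by ring
  rw [Real.rpow_neg hm.le, Real.rpow_neg (by positivity), ← div_eq_mul_inv,
    le_div_iff₀ (by positivity), inv_mul_le_iff₀ (by positivity),
    ← Real.mul_rpow hm.le (by positivity)]
  gcongr
  linarith

variable {E : Type*} [NormedAddCommGroup E] [NormedSpace ℝ E]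

/-- The kernel `t / max(|z - x|, t)^{d + 1}` in dimension `d`. It is comparable to the Poisson
kernel `t / (|z - x|² + t²)^{(d + 1) / 2}` of the upper half-space. -/
noncomputable def poissonWeight (t : ℝ) (x z : E) : ℝ :=
  t * max ‖z - x‖ t ^ (-(finrank ℝ E + 1 : ℝ))

lemma poissonWeight_pos {t : ℝ} (ht : 0 < t) (x z : E) : 0 < poissonWeight t x z := by
  have : 0 < max ‖z - x‖ t := lt_max_of_lt_right ht
  unfold poissonWeight
  positivity

lemma continuous_poissonWeight {t : ℝ} (ht : 0 < t) (x : E) : Continuous (poissonWeight t x) :=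
  continuous_const.mul ((by fun_prop : Continuous fun z : E => max ‖z - x‖ t).rpow_const
    fun _ => .inl (lt_max_of_lt_right ht).ne')

lemma tendsto_poissonWeight_div_atTop (x z : E) :
    Tendsto (fun t => poissonWeight t x z / t) atTop (𝓝 0) := by
  have hpow : Tendsto (fun t : ℝ => t ^ (-(finrank ℝ E + 1 : ℝ))) atTop (𝓝 0) :=
    tendsto_rpow_neg_atTop (by positivity)
  refine hpow.congr' ?_
  filter_upwards [eventually_gt_atTop 0, eventually_ge_atTop ‖z - x‖] with t ht htz
  rw [poissonWeight, max_eq_right htz, mul_div_cancel_left₀ _ ht.ne']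

lemma poissonWeight_le_mul_poissonWeight_one {t : ℝ} (ht : 1 ≤ t) (x z : E) :
    poissonWeight t x z ≤ t * poissonWeight 1 x z := by
  unfold poissonWeight
  rw [one_mul]
  exact mul_le_mul_of_nonneg_left (Real.rpow_le_rpow_of_nonpos (by positivity)
    (max_le_max le_rfl ht) (by linarith)) (by linarith)

lemma poissonWeight_le_of_le_norm {t δ : ℝ} (ht : 0 < t) (hδ : 0 < δ) (hδ1 : δ ≤ 1) {x z : E}
    (hz : δ ≤ ‖z - x‖) :
    poissonWeight t x z ≤ t * δ ^ (-(finrank ℝ E + 1 : ℝ)) * poissonWeight 1 x z := by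
  unfold poissonWeight
  rw [one_mul, mul_assoc, ← Real.mul_rpow hδ.le (by positivity)]
  have hmax : δ * max ‖z - x‖ 1 ≤ max ‖z - x‖ t := by
    rw [mul_max_of_nonneg _ _ hδ.le, mul_one]
    exact (max_le (mul_le_of_le_one_left (norm_nonneg _) hδ1) hz).trans (le_max_left _ _)
  exact mul_le_mul_of_nonneg_left
    (Real.rpow_le_rpow_of_nonpos (by positivity) hmax (by linarith)) ht.le

variable [MeasurableSpace E] {μ : Measure E} {f : E → ℝ≥0∞}

variable (μ) in
/-- The mean of `f` against `poissonWeight t x`. These means dominate all averages of `f` with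
Schwartz profile at scale `t`, and are in turn dominated by the maximal function. -/
noncomputable def poissonMean (f : E → ℝ≥0∞) (t : ℝ) (x : E) : ℝ≥0∞ :=
  ∫⁻ z, f z * ENNReal.ofReal (poissonWeight t x z) ∂μ

lemma poissonMean_ne_top {c : ℝ} (hc : c ≤ finrank ℝ E + 1)
    (hf : ∫⁻ z, f z * ENNReal.ofReal ((1 + ‖z‖) ^ (-c)) ∂μ ≠ ∞) {t : ℝ} (ht : 0 < t) (x : E) :
    poissonMean μ f t x ≠ ∞ := by
  set K := t * ((1 + ‖x‖) / t + 1) ^ (finrank ℝ E + 1 : ℝ) with hK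
  refine ne_top_of_le_ne_top
    (ENNReal.mul_ne_top (a := ENNReal.ofReal K) ENNReal.ofReal_ne_top hf) ?_
  rw [← lintegral_const_mul' _ _ ENNReal.ofReal_ne_top]
  refine lintegral_mono fun z => ?_
  dsimp only
  rw [mul_left_comm, ← ENNReal.ofReal_mul (by positivity), hK, mul_assoc]
  gcongr
  calc poissonWeight t x z
      ≤ t * (((1 + ‖x‖) / t + 1) ^ (finrank ℝ E + 1 : ℝ) *
          (1 + ‖z‖) ^ (-(finrank ℝ E + 1 : ℝ))) :=
        mul_le_mul_of_nonneg_left (max_norm_sub_rpow_neg_le (by positivity) ht x z) ht.le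
    _ ≤ _ := by
        gcongr
        linarith [norm_nonneg z]

variable [BorelSpace E]

lemma poissonMean_le_indicator_closedBall_add (hf : AEMeasurable f μ) {t δ : ℝ} (ht : 0 < t)
    (hδ : 0 < δ) (hδ1 : δ ≤ 1) (x : E) :
    poissonMean μ f t x ≤ poissonMean μ ((closedBall x δ).indicator f) t x +
      ENNReal.ofReal (t * δ ^ (-(finrank ℝ E + 1 : ℝ))) * poissonMean μ f 1 x := by
  have hmeas : AEMeasurable (fun z => (closedBall x δ).indicator f z *
      ENNReal.ofReal (poissonWeight t x z)) μ :=
    (hf.indicator measurableSet_closedBall).mul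
      (continuous_poissonWeight ht x).measurable.ennreal_ofReal.aemeasurable
  unfold poissonMean
  rw [← lintegral_const_mul' _ _ ENNReal.ofReal_ne_top, ← lintegral_add_left' hmeas]
  refine lintegral_mono fun z => ?_
  by_cases hz : z ∈ closedBall x δ
  · simp only [indicator_of_mem hz]
    exact le_self_add
  · have hz' : δ ≤ ‖z - x‖ := by
      rw [mem_closedBall, dist_eq_norm, not_le] at hz
      exact hz.le
    simp only [indicator_of_notMem hz, zero_mul, zero_add]
    rw [mul_left_comm, ← ENNReal.ofReal_mul (by positivity)]
    gcongr
    exact poissonWeight_le_of_le_norm ht hδ hδ1 hz'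

lemma tendsto_poissonMean_div_atTop (hf : AEMeasurable f μ) {x : E}
    (hfin : poissonMean μ f 1 x ≠ ∞) :
    Tendsto (fun t => poissonMean μ f t x / ENNReal.ofReal t) atTop (𝓝 0) := by
  have hdiv : ∀ᶠ t : ℝ in atTop, poissonMean μ f t x / ENNReal.ofReal t =
      ∫⁻ z, f z * ENNReal.ofReal (poissonWeight t x z / t) ∂μ := by
    filter_upwards [eventually_gt_atTop 0] with t ht
    rw [poissonMean, div_eq_mul_inv, ← ENNReal.ofReal_inv_of_pos ht,
      ← lintegral_mul_const' _ _ ENNReal.ofReal_ne_top]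
    refine lintegral_congr fun z => ?_
    rw [mul_assoc, ← ENNReal.ofReal_mul ((poissonWeight_pos ht x z).le), div_eq_mul_inv]
  rw [tendsto_congr' hdiv, ← lintegral_zero (μ := μ)]
  refine tendsto_lintegral_filter_of_dominated_convergence'
    (fun z => f z * ENNReal.ofReal (poissonWeight 1 x z)) ?_ ?_ hfin ?_
  · filter_upwards [eventually_gt_atTop 0] with t ht
    exact hf.mul
      ((continuous_poissonWeight ht x).measurable.div_const t).ennreal_ofReal.aemeasurable
  · filter_upwards [eventually_ge_atTop 1] with t ht
    refine .of_forall fun z => ?_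
    gcongr
    exact div_le_of_le_mul₀ (by positivity) (poissonWeight_pos one_pos x z).le
      ((poissonWeight_le_mul_poissonWeight_one ht x z).trans_eq (mul_comm _ _))
  · have hmeas : AEMeasurable (fun z => f z * ENNReal.ofReal (poissonWeight 1 x z)) μ :=
      hf.mul (continuous_poissonWeight one_pos x).measurable.ennreal_ofReal.aemeasurable
    filter_upwards [ae_lt_top' hmeas hfin] with z hz
    have hfz : f z ≠ ∞ := (ENNReal.lt_top_of_mul_ne_top_left hz.ne
      (ENNReal.ofReal_pos.2 (poissonWeight_pos one_pos x z)).ne').ne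
    simpa using ENNReal.Tendsto.const_mul
      (ENNReal.tendsto_ofReal (tendsto_poissonWeight_div_atTop x z)) (.inr hfz)

variable [FiniteDimensional ℝ E]

variable (μ) in
lemma exists_poissonMean_le_maximalFn [μ.IsAddHaarMeasure] :
    ∃ C : ℝ≥0, ∀ f : E → ℝ≥0∞, AEMeasurable f μ → ∀ t : ℝ, 0 < t → ∀ x,
      poissonMean μ f t x ≤ C * maximalFn μ f x := by
  obtain ⟨C, hC⟩ := exists_lintegral_mul_max_rpow_le μ one_pos
  refine ⟨C, fun f hf t ht x => ?_⟩
  calc poissonMean μ f t x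
      = ENNReal.ofReal t *
          ∫⁻ z, f z * ENNReal.ofReal (max ‖z - x‖ t ^ (-(finrank ℝ E + 1 : ℝ))) ∂μ := by
        rw [← lintegral_const_mul' _ _ ENNReal.ofReal_ne_top]
        refine lintegral_congr fun z => ?_
        rw [poissonWeight, ENNReal.ofReal_mul ht.le, mul_left_comm]
    _ ≤ ENNReal.ofReal t * (C * ENNReal.ofReal (t ^ (-1 : ℝ)) * maximalFn μ f x) := by
        gcongr
        exact hC f hf x t ht
    _ = ENNReal.ofReal (t * t ^ (-1 : ℝ)) * (C * maximalFn μ f x) := by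
        rw [ENNReal.ofReal_mul ht.le]
        ring
    _ = C * maximalFn μ f x := by
        rw [Real.rpow_neg_one, mul_inv_cancel₀ ht.ne', ENNReal.ofReal_one, one_mul]

lemma maximalFn_indicator_closedBall_le [μ.IsAddHaarMeasure] {ε : ℝ≥0∞} {δ : ℝ} {x : E}
    (h : ∀ r, 0 < r → r ≤ δ → ∫⁻ z in closedBall x r, f z ∂μ ≤ ε * μ (closedBall x r))
    (hδ : 0 < δ) : maximalFn μ ((closedBall x δ).indicator f) x ≤ ε := by
  refine maximalFn_le_iff.2 fun k => ?_
  rw [setLIntegral_indicator measurableSet_closedBall]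
  rcases le_total ((2 : ℝ) ^ k) δ with hk | hk
  · rw [inter_eq_self_of_subset_right (closedBall_subset_closedBall hk)]
    exact h _ (by positivity) hk
  · rw [inter_eq_self_of_subset_left (closedBall_subset_closedBall hk)]
    exact (h δ hδ le_rfl).trans (by gcongr)

lemma tendsto_poissonMean_zero [μ.IsAddHaarMeasure] (hf : AEMeasurable f μ) {x : E}
    (hfin : poissonMean μ f 1 x ≠ ∞)
    (hx : Tendsto (fun r => (∫⁻ z in closedBall x r, f z ∂μ) / μ (closedBall x r)) (𝓝[>] 0)
      (𝓝 0)) :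
    Tendsto (fun t => poissonMean μ f t x) (𝓝[>] 0) (𝓝 0) := by
  obtain ⟨C, hC⟩ := exists_poissonMean_le_maximalFn μ
  rw [ENNReal.tendsto_nhds_zero] at hx ⊢
  intro ε hε
  obtain ⟨η, hη, hηε⟩ : ∃ η : ℝ≥0∞, 0 < η ∧ C * η ≤ ε / 2 := by
    refine ⟨ε / 2 / (C + 1), ENNReal.div_pos (ENNReal.half_pos hε.ne').ne' (by finiteness), ?_⟩
    rw [← mul_div_assoc]
    exact ENNReal.div_le_of_le_mul (by rw [mul_comm]; gcongr; exact le_self_add)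
  obtain ⟨δ₀, hδ₀, hball⟩ := mem_nhdsGT_iff_exists_Ioc_subset.1 (hx η hη)
  set δ := min δ₀ 1
  have hδ : 0 < δ := lt_min hδ₀ one_pos
  have hnear : maximalFn μ ((closedBall x δ).indicator f) x ≤ η :=
    maximalFn_indicator_closedBall_le (fun r hr hrδ =>
      (ENNReal.div_le_iff (measure_closedBall_pos μ x hr).ne' measure_closedBall_lt_top.ne).1
        (hball ⟨hr, hrδ.trans (min_le_left _ _)⟩)) hδ
  have hfar : Tendsto (fun t => ENNReal.ofReal (t * δ ^ (-(finrank ℝ E + 1 : ℝ))) *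
      poissonMean μ f 1 x) (𝓝[>] 0) (𝓝 0) := by
    have h0 : Tendsto (fun t : ℝ => t * δ ^ (-(finrank ℝ E + 1 : ℝ))) (𝓝[>] 0) (𝓝 0) :=
      ((continuous_mul_const _).tendsto' 0 0 (zero_mul _)).mono_left nhdsWithin_le_nhds
    simpa using ENNReal.Tendsto.mul_const (ENNReal.tendsto_ofReal h0) (.inr hfin)
  filter_upwards [self_mem_nhdsWithin,
    ENNReal.tendsto_nhds_zero.1 hfar (ε / 2) (ENNReal.half_pos hε.ne')] with t ht hft
  calc poissonMean μ f t x
      ≤ poissonMean μ ((closedBall x δ).indicator f) t x +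
          ENNReal.ofReal (t * δ ^ (-(finrank ℝ E + 1 : ℝ))) * poissonMean μ f 1 x :=
        poissonMean_le_indicator_closedBall_add hf ht hδ (min_le_right _ _) x
    _ ≤ C * η + ε / 2 := by
        gcongr
        exact (hC _ (hf.indicator measurableSet_closedBall) t ht x).trans (by gcongr)
    _ ≤ ε := (add_le_add_left hηε _).trans_eq (ENNReal.add_halves ε)

end PoissonMeans

section LebesguePoints

variable {E F : Type*} [NormedAddCommGroup E] [MeasurableSpace E] [NormedAddCommGroup F]

/-- `x` is a Lebesgue point of `u`: the mean oscillation of `u` about `u x` over small balls centred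
at `x` tends to zero. -/
def IsLebesguePoint (μ : Measure E) (u : E → F) (x : E) : Prop :=
  Tendsto (fun r => (∫⁻ z in closedBall x r, ‖u z - u x‖ₑ ∂μ) / μ (closedBall x r)) (𝓝[>] 0) (𝓝 0)

variable [NormedSpace ℝ E] [FiniteDimensional ℝ E] [BorelSpace E] {μ : Measure E}
  [μ.IsAddHaarMeasure]

lemma ae_isLebesguePoint {u : E → F} (hu : LocallyIntegrable u μ) :
    ∀ᵐ x ∂μ, IsLebesguePoint μ u x := by
  filter_upwards [(IsUnifLocDoublingMeasure.vitaliFamily μ 1).ae_tendsto_lintegral_enorm_sub_div hu]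
    with x hx
  refine hx.comp (IsUnifLocDoublingMeasure.tendsto_closedBall_filterAt μ (fun _ : ℝ => x)
    (fun r : ℝ => r) tendsto_id ?_)
  filter_upwards [self_mem_nhdsWithin] with r hr
  exact mem_closedBall_self (by simpa using (mem_Ioi.1 hr).le)

lemma IsLebesguePoint.tendsto_poissonMean {u : E → F} {x : E} (hx : IsLebesguePoint μ u x)
    (hu : AEStronglyMeasurable u μ) (hfin : poissonMean μ (fun z => ‖u z‖ₑ) 1 x ≠ ∞) :
    Tendsto (fun t => poissonMean μ (fun z => ‖u z - u x‖ₑ) t x) (𝓝[>] 0) (𝓝 0) := by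
  refine tendsto_poissonMean_zero (hu.sub aestronglyMeasurable_const).enorm ?_ hx
  obtain ⟨C, hC⟩ := exists_poissonMean_le_maximalFn μ
  have hone : poissonMean μ (fun _ => ‖u x‖ₑ) 1 x ≤ C * ‖u x‖ₑ :=
    (hC _ aemeasurable_const 1 one_pos x).trans
      (mul_le_mul_right (maximalFn_le_of_ae_le (.of_forall fun _ => le_rfl) x) _)
  have hmeas : AEMeasurable (fun z => ‖u z‖ₑ * ENNReal.ofReal (poissonWeight 1 x z)) μ :=
    hu.enorm.mul (continuous_poissonWeight one_pos x).measurable.ennreal_ofReal.aemeasurable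
  have hsum : poissonMean μ (fun z => ‖u z - u x‖ₑ) 1 x ≤
      poissonMean μ (fun z => ‖u z‖ₑ) 1 x + poissonMean μ (fun _ => ‖u x‖ₑ) 1 x := by
    unfold poissonMean
    rw [← lintegral_add_left' hmeas]
    refine lintegral_mono fun z => ?_
    rw [← add_mul]
    gcongr
    exact enorm_sub_le
  exact ne_top_of_le_ne_top (ENNReal.add_ne_top.2
    ⟨hfin, ne_top_of_le_ne_top (by finiteness) hone⟩) hsum

end LebesguePoints

section SchwartzAverages

variable {E F : Type*} [NormedAddCommGroup E] [NormedSpace ℝ E] [NormedAddCommGroup F]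
  [NormedSpace ℝ F]

lemma exists_norm_schwartz_le (φ : 𝓢(E, F)) (N : ℕ) :
    ∃ B : ℝ≥0, ∀ w, ‖φ w‖ ≤ B * ((1 + ‖w‖) ^ N)⁻¹ := by
  refine ⟨⟨2 ^ N * ((Finset.Iic (N, 0)).sup fun m => SchwartzMap.seminorm ℝ m.1 m.2) φ,
    by positivity⟩, fun w => ?_⟩
  rw [← div_eq_mul_inv, le_div_iff₀' (by positivity), ← norm_iteratedFDeriv_zero (𝕜 := ℝ)]
  exact φ.one_add_le_sup_seminorm_apply (𝕜 := ℝ) (m := (N, 0)) le_rfl le_rfl w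

lemma exists_norm_schwartz_sub_le (φ : 𝓢(E, F)) (N : ℕ) :
    ∃ B : ℝ≥0, ∀ w w', ‖w' - w‖ ≤ 1 →
      ‖φ w' - φ w‖ ≤ B * ‖w' - w‖ * ((1 + ‖w‖) ^ N)⁻¹ := by
  obtain ⟨B, hB⟩ := exists_norm_schwartz_le (SchwartzMap.fderivCLM ℝ E F φ) N
  refine ⟨B * 2 ^ N, fun w w' hw => ?_⟩
  have hfderiv : ∀ v ∈ closedBall w 1, ‖fderiv ℝ φ v‖ ≤ B * 2 ^ N * ((1 + ‖w‖) ^ N)⁻¹ := by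
    intro v hv
    have hwv : 1 + ‖w‖ ≤ 2 * (1 + ‖v‖) := by
      have := norm_le_norm_add_norm_sub v w
      rw [mem_closedBall, dist_eq_norm] at hv
      linarith [norm_nonneg v]
    calc ‖fderiv ℝ φ v‖ ≤ B * ((1 + ‖v‖) ^ N)⁻¹ := hB v
      _ = B * 2 ^ N * ((2 * (1 + ‖v‖)) ^ N)⁻¹ := by
          rw [mul_pow]
          field_simp
      _ ≤ B * 2 ^ N * ((1 + ‖w‖) ^ N)⁻¹ := by gcongr
  calc ‖φ w' - φ w‖ ≤ B * 2 ^ N * ((1 + ‖w‖) ^ N)⁻¹ * ‖w' - w‖ :=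
        (convex_closedBall w 1).norm_image_sub_le_of_norm_fderiv_le (𝕜 := ℝ)
          (fun v _ => φ.differentiableAt) hfderiv (mem_closedBall_self zero_le_one)
          (mem_closedBall_iff_norm.2 hw)
    _ = _ := by
        push_cast
        ring

/-- The `L¹`-normalised dilate `t⁻ᵈ χ((z - x) / t)` of a Schwartz function on a space of
dimension `d`. -/
noncomputable def scaleKernel (χ : 𝓢(E, F)) (t : ℝ) (x z : E) : F :=
  (t ^ finrank ℝ E)⁻¹ • χ (t⁻¹ • (z - x))

lemma pow_inv_mul_one_add_norm_pow_inv_le {t : ℝ} (ht : 0 < t) (x z : E) :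
    (t ^ finrank ℝ E)⁻¹ * ((1 + ‖t⁻¹ • (z - x)‖) ^ (finrank ℝ E + 1))⁻¹ ≤ poissonWeight t x z := by
  have hm : 0 < max ‖z - x‖ t := lt_max_of_lt_right ht
  have hmax : max ‖z - x‖ t / t ≤ 1 + ‖t⁻¹ • (z - x)‖ := by
    rw [norm_smul, norm_inv, Real.norm_of_nonneg ht.le, div_le_iff₀ ht, add_mul, one_mul,
      mul_right_comm, inv_mul_cancel₀ ht.ne', one_mul]
    exact max_le (by linarith) (by linarith [norm_nonneg (z - x)])
  calc (t ^ finrank ℝ E)⁻¹ * ((1 + ‖t⁻¹ • (z - x)‖) ^ (finrank ℝ E + 1))⁻¹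
      ≤ (t ^ finrank ℝ E)⁻¹ * ((max ‖z - x‖ t / t) ^ (finrank ℝ E + 1))⁻¹ := by gcongr
    _ = poissonWeight t x z := by
        rw [poissonWeight, Real.rpow_neg hm.le, ← Nat.cast_add_one, Real.rpow_natCast, div_pow,
          pow_succ t]
        field_simp

lemma exists_enorm_scaleKernel_le (χ : 𝓢(E, F)) :
    ∃ B : ℝ≥0, ∀ t, 0 < t → ∀ x z,
      ‖scaleKernel χ t x z‖ₑ ≤ B * ENNReal.ofReal (poissonWeight t x z) := by
  obtain ⟨B, hB⟩ := exists_norm_schwartz_le χ (finrank ℝ E + 1)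
  refine ⟨B, fun t ht x z => ?_⟩
  rw [← ENNReal.ofReal_coe_nnreal, ← ENNReal.ofReal_mul B.coe_nonneg, ← ofReal_norm, scaleKernel,
    norm_smul, Real.norm_of_nonneg (by positivity)]
  refine ENNReal.ofReal_le_ofReal ?_
  calc (t ^ finrank ℝ E)⁻¹ * ‖χ (t⁻¹ • (z - x))‖
      ≤ (t ^ finrank ℝ E)⁻¹ * (B * ((1 + ‖t⁻¹ • (z - x)‖) ^ (finrank ℝ E + 1))⁻¹) := by
        gcongr
        exact hB _
    _ ≤ B * poissonWeight t x z := by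
        rw [mul_left_comm]
        gcongr
        exact pow_inv_mul_one_add_norm_pow_inv_le ht x z

lemma exists_enorm_scaleKernel_sub_le (χ : 𝓢(E, F)) :
    ∃ B : ℝ≥0, ∀ t, 0 < t → ∀ x y, ‖x - y‖ ≤ t → ∀ z,
      ‖scaleKernel χ t x z - scaleKernel χ t y z‖ₑ ≤
        B * ENNReal.ofReal (‖x - y‖ / t) * ENNReal.ofReal (poissonWeight t x z) := by
  obtain ⟨B, hB⟩ := exists_norm_schwartz_sub_le χ (finrank ℝ E + 1)
  refine ⟨B, fun t ht x y hxy z => ?_⟩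
  have hdist : ‖t⁻¹ • (z - y) - t⁻¹ • (z - x)‖ = ‖x - y‖ / t := by
    rw [← smul_sub, norm_smul, norm_inv, Real.norm_of_nonneg ht.le, sub_sub_sub_cancel_left,
      div_eq_inv_mul]
  have hincr := hB (t⁻¹ • (z - x)) (t⁻¹ • (z - y)) (by rwa [hdist, div_le_one ht])
  rw [← ENNReal.ofReal_coe_nnreal, ← ENNReal.ofReal_mul B.coe_nonneg,
    ← ENNReal.ofReal_mul (by positivity), ← ofReal_norm, norm_sub_rev, scaleKernel,
    scaleKernel, ← smul_sub, norm_smul, Real.norm_of_nonneg (by positivity)]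
  refine ENNReal.ofReal_le_ofReal ?_
  calc (t ^ finrank ℝ E)⁻¹ * ‖χ (t⁻¹ • (z - y)) - χ (t⁻¹ • (z - x))‖
      ≤ (t ^ finrank ℝ E)⁻¹ *
          (B * (‖x - y‖ / t) * ((1 + ‖t⁻¹ • (z - x)‖) ^ (finrank ℝ E + 1))⁻¹) := by
        gcongr
        exact hincr.trans_eq (by rw [hdist])
    _ ≤ B * (‖x - y‖ / t) * poissonWeight t x z := by
        rw [mul_left_comm]
        gcongr
        exact pow_inv_mul_one_add_norm_pow_inv_le ht x z

variable [MeasurableSpace E] {μ : Measure E}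

variable (μ) in
/-- The mean of `u` at scale `t` about `x` with profile `χ`. -/
noncomputable def scaleMean (χ : 𝓢(E, ℂ)) (u : E → ℂ) (t : ℝ) (x : E) : ℂ :=
  ∫ z, u z * scaleKernel χ t x z ∂μ

lemma exists_enorm_scaleMean_le (χ : 𝓢(E, ℂ)) :
    ∃ B : ℝ≥0, ∀ (u : E → ℂ) t, 0 < t → ∀ x,
      ‖scaleMean μ χ u t x‖ₑ ≤ B * poissonMean μ (fun z => ‖u z‖ₑ) t x := by
  obtain ⟨B, hB⟩ := exists_enorm_scaleKernel_le χ
  refine ⟨B, fun u t ht x => (enorm_integral_le_lintegral_enorm _).trans ?_⟩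
  unfold poissonMean
  rw [← lintegral_const_mul' _ _ ENNReal.coe_ne_top]
  refine lintegral_mono fun z => ?_
  rw [enorm_mul, mul_left_comm]
  gcongr
  exact hB t ht x z

lemma exists_enorm_scaleMean_sub_le (χ : 𝓢(E, ℂ)) :
    ∃ B : ℝ≥0, ∀ (u : E → ℂ) t, 0 < t →
      (∀ x, Integrable (fun z => u z * scaleKernel χ t x z) μ) → ∀ x y, ‖x - y‖ ≤ t →
        ‖scaleMean μ χ u t x - scaleMean μ χ u t y‖ₑ ≤
          B * ENNReal.ofReal (‖x - y‖ / t) * poissonMean μ (fun z => ‖u z‖ₑ) t x := by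
  obtain ⟨B, hB⟩ := exists_enorm_scaleKernel_sub_le χ
  refine ⟨B, fun u t ht hint x y hxy => ?_⟩
  unfold scaleMean poissonMean
  rw [← integral_sub (hint x) (hint y), ← lintegral_const_mul' _ _ (by finiteness)]
  refine (enorm_integral_le_lintegral_enorm _).trans (lintegral_mono fun z => ?_)
  rw [← mul_sub, enorm_mul, mul_left_comm]
  gcongr
  exact hB t ht x y hxy z

variable [BorelSpace E] {u : E → ℂ} {x : E} {t : ℝ}

lemma integrable_mul_scaleKernel (χ : 𝓢(E, ℂ)) (hu : AEStronglyMeasurable u μ) (ht : 0 < t)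
    (hfin : poissonMean μ (fun z => ‖u z‖ₑ) t x ≠ ∞) :
    Integrable (fun z => u z * scaleKernel χ t x z) μ := by
  obtain ⟨B, hB⟩ := exists_enorm_scaleKernel_le χ
  refine ⟨hu.mul ?_, ?_⟩
  · exact ((χ.continuous.comp (by fun_prop)).const_smul _).aestronglyMeasurable
  · calc ∫⁻ z, ‖u z * scaleKernel χ t x z‖ₑ ∂μ
        ≤ ∫⁻ z, B * (‖u z‖ₑ * ENNReal.ofReal (poissonWeight t x z)) ∂μ := by
          refine lintegral_mono fun z => ?_
          rw [enorm_mul, mul_left_comm]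
          gcongr
          exact hB t ht x z
      _ = B * poissonMean μ (fun z => ‖u z‖ₑ) t x := lintegral_const_mul' _ _ ENNReal.coe_ne_top
      _ < ∞ := ENNReal.mul_lt_top ENNReal.coe_lt_top hfin.lt_top

lemma tendsto_scaleMean_sub_atTop (χ : 𝓢(E, ℂ)) (hu : AEStronglyMeasurable u μ)
    (hfin : ∀ t, 0 < t → ∀ x, poissonMean μ (fun z => ‖u z‖ₑ) t x ≠ ∞) (x y : E) :
    Tendsto (fun t => scaleMean μ χ u t x - scaleMean μ χ u t y) atTop (𝓝 0) := by
  obtain ⟨B, hB⟩ := exists_enorm_scaleMean_sub_le (μ := μ) χ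
  have hlim : Tendsto (fun t => B * ENNReal.ofReal ‖x - y‖ *
      (poissonMean μ (fun z => ‖u z‖ₑ) t x / ENNReal.ofReal t)) atTop (𝓝 0) := by
    simpa using ENNReal.Tendsto.const_mul
      (tendsto_poissonMean_div_atTop hu.enorm (hfin 1 one_pos x)) (.inr (by finiteness))
  rw [tendsto_iff_edist_tendsto_0]
  refine tendsto_of_tendsto_of_tendsto_of_le_of_le' tendsto_const_nhds hlim
    (.of_forall fun _ => zero_le) ?_
  filter_upwards [eventually_gt_atTop 0, eventually_ge_atTop ‖x - y‖] with t ht hxy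
  rw [edist_zero_right]
  refine (hB u t ht (fun w => integrable_mul_scaleKernel χ hu ht (hfin t ht w)) x y hxy).trans_eq ?_
  rw [ENNReal.ofReal_div_of_pos ht]
  simp only [div_eq_mul_inv]
  ring

variable [FiniteDimensional ℝ E]

lemma integral_scaleKernel [μ.IsAddHaarMeasure] (χ : 𝓢(E, F)) {t : ℝ} (ht : 0 < t) (x : E) :
    ∫ z, scaleKernel χ t x z ∂μ = ∫ z, χ z ∂μ := by
  unfold scaleKernel
  rw [integral_smul, integral_sub_right_eq_self (fun z => χ (t⁻¹ • z)) x,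
    Measure.integral_comp_smul μ (fun z => χ z) t⁻¹, inv_pow, inv_inv, abs_of_pos (by positivity),
    inv_smul_smul₀ (by positivity)]

lemma IsLebesguePoint.tendsto_scaleMean [μ.IsAddHaarMeasure] (hx : IsLebesguePoint μ u x)
    (hu : AEStronglyMeasurable u μ) (hfin : ∀ t, 0 < t → poissonMean μ (fun z => ‖u z‖ₑ) t x ≠ ∞)
    {χ : 𝓢(E, ℂ)} (hχ : ∫ z, χ z ∂μ = 1) :
    Tendsto (fun t => scaleMean μ χ u t x) (𝓝[>] 0) (𝓝 (u x)) := by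
  obtain ⟨B, hB⟩ := exists_enorm_scaleMean_le (μ := μ) χ
  have hsub (t : ℝ) (ht : 0 < t) :
      scaleMean μ χ u t x - u x = scaleMean μ χ (fun z => u z - u x) t x := by
    have hint : Integrable (scaleKernel χ t x) μ := by
      by_contra h
      have := integral_scaleKernel (μ := μ) χ ht x
      rw [integral_undef h, hχ] at this
      exact zero_ne_one this
    unfold scaleMean
    simp_rw [sub_mul]
    rw [integral_sub (integrable_mul_scaleKernel χ hu ht (hfin t ht)) (hint.const_mul _),
      integral_const_mul, integral_scaleKernel χ ht x, hχ, mul_one]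
  have hlim : Tendsto (fun t => B * poissonMean μ (fun z => ‖u z - u x‖ₑ) t x) (𝓝[>] 0) (𝓝 0) := by
    simpa using ENNReal.Tendsto.const_mul (hx.tendsto_poissonMean hu (hfin 1 one_pos))
      (.inr ENNReal.coe_ne_top)
  rw [tendsto_iff_edist_tendsto_0]
  refine tendsto_of_tendsto_of_tendsto_of_le_of_le' tendsto_const_nhds hlim
    (.of_forall fun _ => zero_le) ?_
  filter_upwards [self_mem_nhdsWithin] with t ht
  rw [edist_eq_enorm_sub, hsub t ht]
  exact hB _ t ht x

end SchwartzAverages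

section TestFunctions

section Dilation

variable {V F : Type*} [NormedAddCommGroup V] [NormedSpace ℝ V] [NormedAddCommGroup F]
  [NormedSpace ℝ F]

/-- The Schwartz function `z ↦ φ (R • (z - x))`. -/
noncomputable def dilateAt (φ : 𝓢(V, F)) {R : ℝ} (hR : R ≠ 0) (x : V) : 𝓢(V, F) :=
  SchwartzMap.compSubConstCLM ℝ x (SchwartzMap.compCLMOfContinuousLinearEquiv ℝ
    (ContinuousLinearEquiv.smulLeft (Units.mk0 R hR)) φ)

lemma dilateAt_apply (φ : 𝓢(V, F)) {R : ℝ} (hR : R ≠ 0) (x z : V) :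
    dilateAt φ hR x z = φ (R • (z - x)) := rfl

end Dilation

section Fourier

variable {V : Type*} [NormedAddCommGroup V] [InnerProductSpace ℝ V] [FiniteDimensional ℝ V]
  [MeasurableSpace V] [BorelSpace V] {R : ℝ}

lemma fourier_comp_smul_sub (f : V → ℂ) (hR : 0 < R) (x ξ : V) :
    𝓕 (fun z => f (R • (z - x))) ξ =
      ((R ^ finrank ℝ V)⁻¹ : ℝ) *
        (Complex.exp (↑(-2 * Real.pi * inner ℝ x ξ) * Complex.I) * 𝓕 f (R⁻¹ • ξ)) := by
  rw [Real.fourier_eq', Real.fourier_eq', ← integral_add_right_eq_self _ x]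
  have hscale := Measure.integral_comp_smul (volume : Measure V)
    (fun w => Complex.exp (↑(-2 * Real.pi * inner ℝ (R⁻¹ • w + x) ξ) * Complex.I) • f w) R
  simp only [inv_smul_smul₀ hR.ne'] at hscale
  simp only [add_sub_cancel_right]
  rw [hscale, ← integral_const_mul, abs_of_pos (by positivity), Complex.real_smul]
  congr 2
  ext w
  rw [smul_eq_mul, smul_eq_mul, ← mul_assoc, ← Complex.exp_add]
  congr 2
  rw [inner_add_left, real_inner_smul_left, real_inner_smul_right]
  push_cast
  ring

lemma fourierInv_exp_mul_comp_inv_smul (f : V → ℂ) (hR : 0 < R) (x z : V) :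
    𝓕⁻ (fun ξ => ((R ^ finrank ℝ V)⁻¹ : ℝ) *
        (Complex.exp (↑(-2 * Real.pi * inner ℝ x ξ) * Complex.I) * f (R⁻¹ • ξ))) z =
      𝓕⁻ f (R • (z - x)) := by
  rw [Real.fourierInv_eq', Real.fourierInv_eq']
  have hscale := Measure.integral_comp_smul (volume : Measure V)
    (fun η => Complex.exp (↑(2 * Real.pi * inner ℝ η (R • (z - x))) * Complex.I) • f η) R⁻¹
  rw [inv_pow, inv_inv, abs_of_pos (by positivity), ← inv_smul_eq_iff₀ (by positivity),
    ← integral_smul] at hscale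
  rw [← hscale]
  congr 1
  ext ξ
  have hexp : Complex.exp (↑(2 * Real.pi * inner ℝ (R⁻¹ • ξ) (R • (z - x))) * Complex.I) =
      Complex.exp (↑(2 * Real.pi * inner ℝ ξ z) * Complex.I) *
        Complex.exp (↑(-2 * Real.pi * inner ℝ x ξ) * Complex.I) := by
    rw [← Complex.exp_add, real_inner_smul_left, real_inner_smul_right, inner_sub_right,
      real_inner_comm x ξ, inv_mul_cancel_left₀ hR.ne']
    push_cast
    ring_nf
  rw [hexp]
  simp only [smul_eq_mul, Complex.real_smul]
  ring

end Fourier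

variable {n : ℕ}

lemma fracDerivSchwartz_dilateAt (s : ℝ) (φ : 𝓢(EuclideanSpace ℝ (Fin n), ℂ)) {R : ℝ}
    (hR : 0 < R) (x z : EuclideanSpace ℝ (Fin n)) :
    fracDerivSchwartz s (dilateAt φ hR.ne' x) z =
      ((R ^ s : ℝ) : ℂ) * fracDerivSchwartz s φ (R • (z - x)) := by
  have hnorm (ξ : EuclideanSpace ℝ (Fin n)) : ‖ξ‖ ^ s = R ^ s * ‖R⁻¹ • ξ‖ ^ s := by
    rw [norm_smul, norm_inv, Real.norm_of_nonneg hR.le, Real.mul_rpow (by positivity)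
      (by positivity), Real.inv_rpow hR.le, mul_inv_cancel_left₀ (by positivity)]
  unfold fracDerivSchwartz
  rw [← fourierInv_exp_mul_comp_inv_smul _ hR, Real.fourierInv_eq', Real.fourierInv_eq',
    ← integral_const_mul]
  congr 1
  ext ξ
  rw [funext (dilateAt_apply φ hR.ne' x), fourier_comp_smul_sub _ hR, hnorm]
  simp only [smul_eq_mul]
  push_cast
  ring

lemma exists_schwartz_hasCompactSupport_eq_one :
    ∃ b : 𝓢(EuclideanSpace ℝ (Fin n), ℂ), HasCompactSupport b ∧ ∀ ξ ∈ closedBall 0 1, b ξ = 1 := by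
  let b : ContDiffBump (0 : EuclideanSpace ℝ (Fin n)) := ⟨1, 2, one_pos, one_lt_two⟩
  have hsupp : HasCompactSupport (fun ξ => (b ξ : ℂ)) :=
    b.hasCompactSupport.comp_left (g := fun x : ℝ => (x : ℂ)) Complex.ofReal_zero
  refine ⟨hsupp.toSchwartzMap (Complex.ofRealCLM.contDiff.comp b.contDiff), hsupp, fun ξ hξ => ?_⟩
  change (b ξ : ℂ) = 1
  rw [b.one_of_mem_closedBall hξ, Complex.ofReal_one]

lemma exists_fracDerivSchwartz_eq_fourierInv (s : ℝ) {d : 𝓢(EuclideanSpace ℝ (Fin n), ℂ)}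
    (hd : HasCompactSupport d) (hd0 : ∀ ξ ∈ closedBall 0 1, d ξ = 0) :
    ∃ θ : 𝓢(EuclideanSpace ℝ (Fin n), ℂ), fracDerivSchwartz s θ = 𝓕⁻ d := by
  let m : EuclideanSpace ℝ (Fin n) → ℂ := fun ξ => ((‖ξ‖ ^ (-s) : ℝ) : ℂ) * d ξ
  have hm : ContDiff ℝ ((⊤ : ℕ∞) : WithTop ℕ∞) m := by
    refine contDiff_iff_contDiffAt.2 fun ξ => ?_
    rcases eq_or_ne ξ 0 with rfl | hξ
    · refine (contDiffAt_const (c := (0 : ℂ))).congr_of_eventuallyEq ?_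
      filter_upwards [closedBall_mem_nhds 0 one_pos] with ξ hξ
      simp only [m, hd0 ξ hξ, mul_zero]
    · exact (Complex.ofRealCLM.contDiff.contDiffAt.comp ξ ((contDiffAt_norm ℝ hξ).rpow_const_of_ne
        (norm_ne_zero_iff.2 hξ))).mul (d.smooth ⊤).contDiffAt
  let mS : 𝓢(EuclideanSpace ℝ (Fin n), ℂ) := hd.mul_left.toSchwartzMap hm
  refine ⟨𝓕⁻ mS, ?_⟩
  have hsymbol : (fun ξ => ((‖ξ‖ ^ s : ℝ) : ℂ) *
      𝓕 (⇑(𝓕⁻ mS : 𝓢(EuclideanSpace ℝ (Fin n), ℂ))) ξ) = d := by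
    ext ξ
    rw [← SchwartzMap.fourier_coe, FourierTransform.fourier_fourierInv_eq]
    change _ * (_ * d ξ) = d ξ
    by_cases hξ : ξ ∈ closedBall 0 1
    · rw [hd0 ξ hξ, mul_zero, mul_zero]
    · have hpos : 0 < ‖ξ‖ := one_pos.trans (by simpa using hξ)
      rw [← mul_assoc, ← Complex.ofReal_mul, ← Real.rpow_add hpos, add_neg_cancel, Real.rpow_zero,
        Complex.ofReal_one, one_mul]
  unfold fracDerivSchwartz
  rw [hsymbol, SchwartzMap.fourierInv_coe]

/-- The symbol of `χ` is a cutoff equal to one near the origin, so the symbol of the difference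
vanishes there and may be divided by `‖ξ‖ ^ s`. -/
lemma exists_littlewoodPaley_kernel (n : ℕ) (s : ℝ) :
    ∃ χ θ : 𝓢(EuclideanSpace ℝ (Fin n), ℂ), ∫ z, χ z = 1 ∧
      ∀ w, fracDerivSchwartz s θ w = (2 : ℂ) ^ n * χ ((2 : ℝ) • w) - χ w := by
  obtain ⟨b, hb, hb1⟩ := exists_schwartz_hasCompactSupport_eq_one (n := n)
  obtain ⟨b', hb'_apply⟩ : ∃ b' : 𝓢(EuclideanSpace ℝ (Fin n), ℂ), ∀ ξ,
      b' ξ = b ((2⁻¹ : ℝ) • (ξ - 0)) := ⟨dilateAt b (by norm_num) 0, dilateAt_apply b _ 0⟩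
  have hb' : HasCompactSupport b' := by
    simpa only [funext hb'_apply, sub_zero] using hb.comp_smul (by norm_num : (2⁻¹ : ℝ) ≠ 0)
  have hzero : ∀ ξ ∈ closedBall 0 1, (b' - b) ξ = 0 := fun ξ hξ => by
    rw [mem_closedBall_zero_iff] at hξ
    have hhalf : (2⁻¹ : ℝ) • (ξ - 0) ∈ closedBall (0 : EuclideanSpace ℝ (Fin n)) 1 := by
      rw [mem_closedBall_zero_iff, norm_smul, sub_zero]
      norm_num
      linarith
    rw [sub_apply, hb'_apply, hb1 _ hhalf, hb1 _ (mem_closedBall_zero_iff.2 hξ), sub_self]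
  have hsupp : HasCompactSupport (⇑b' - ⇑b) := hb'.sub hb
  rw [← FunLike.coe_sub] at hsupp
  obtain ⟨θ, hθ⟩ := exists_fracDerivSchwartz_eq_fourierInv s hsupp hzero
  refine ⟨𝓕⁻ b, θ, ?_, fun w => ?_⟩
  · have h0 : 𝓕 (𝓕⁻ b) 0 = 1 := by
      rw [FourierTransform.fourier_fourierInv_eq, hb1 _ (mem_closedBall_self zero_le_one)]
    rw [SchwartzMap.fourier_coe, Real.fourier_eq'] at h0
    simpa using h0
  · have hb'w : 𝓕⁻ b' w = (2 : ℂ) ^ n * 𝓕⁻ b ((2 : ℝ) • w) := by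
      rw [SchwartzMap.fourierInv_coe, SchwartzMap.fourierInv_coe, Real.fourierInv_eq_fourier_neg,
        Real.fourierInv_eq_fourier_neg, funext hb'_apply, fourier_comp_smul_sub _ (by norm_num)]
      simp
    rw [hθ, ← hb'w, ← sub_apply]
    congr 1
    rw [sub_eq_add_neg, ← neg_one_smul ℂ b, FourierTransform.fourierInv_add,
      FourierTransform.fourierInv_smul]
    simp only [neg_smul, one_smul, ← sub_eq_add_neg]

end TestFunctions

section Weights

variable {n : ℕ} {c : ℝ} {u : EuclideanSpace ℝ (Fin n) → ℂ}

lemma locallyIntegrable_of_integrable_rpow_mul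
    (hu : Integrable (fun x => (((1 + ‖x‖) ^ (-c) : ℝ) : ℂ) * u x) volume) :
    LocallyIntegrable u volume := by
  have hcont : Continuous fun x : EuclideanSpace ℝ (Fin n) => (((1 + ‖x‖) ^ c : ℝ) : ℂ) :=
    Complex.continuous_ofReal.comp (Continuous.rpow_const (by fun_prop)
      fun x => .inl (by positivity))
  refine (hu.locallyIntegrable.continuous_smul hcont).congr (.of_forall fun x => ?_)
  change (((1 + ‖x‖) ^ c : ℝ) : ℂ) * ((((1 + ‖x‖) ^ (-c) : ℝ) : ℂ) * u x) = u x
  rw [← mul_assoc, ← Complex.ofReal_mul, ← Real.rpow_add (by positivity), add_neg_cancel,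
    Real.rpow_zero, Complex.ofReal_one, one_mul]

lemma lintegral_enorm_mul_rpow_ne_top
    (hu : Integrable (fun x => (((1 + ‖x‖) ^ (-c) : ℝ) : ℂ) * u x) volume) :
    ∫⁻ x, ‖u x‖ₑ * ENNReal.ofReal ((1 + ‖x‖) ^ (-c)) ≠ ∞ := by
  convert hu.2.ne using 3 with x
  rw [enorm_mul, mul_comm, ← ofReal_norm (((1 + ‖x‖) ^ (-c) : ℝ) : ℂ), Complex.norm_real,
    Real.norm_of_nonneg (by positivity)]

end Weights

section Hajlasz

variable {n : ℕ} {s : ℝ} {u g : EuclideanSpace ℝ (Fin n) → ℂ}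
  {χ θ : 𝓢(EuclideanSpace ℝ (Fin n), ℂ)}

lemma HasFracDeriv.poissonMean_enorm_ne_top (h : HasFracDeriv s u g) (hs : s ≤ 1) {t : ℝ}
    (ht : 0 < t) (x : EuclideanSpace ℝ (Fin n)) : poissonMean volume (fun z => ‖u z‖ₑ) t x ≠ ∞ :=
  poissonMean_ne_top (c := n + s) (by rw [finrank_euclideanSpace_fin]; linarith)
    (lintegral_enorm_mul_rpow_ne_top h.1) ht x

lemma scaleKernel_eq_dilateAt {t : ℝ} (ht : 0 < t) (x z : EuclideanSpace ℝ (Fin n)) :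
    scaleKernel θ t x z = (((t ^ n)⁻¹ : ℝ) : ℂ) * dilateAt θ (inv_pos.2 ht).ne' x z := by
  rw [scaleKernel, dilateAt_apply, Complex.real_smul, finrank_euclideanSpace_fin]

lemma HasFracDeriv.integrable_deriv_mul_scaleKernel (h : HasFracDeriv s u g)
    (θ : 𝓢(EuclideanSpace ℝ (Fin n), ℂ)) {t : ℝ} (ht : 0 < t) (x : EuclideanSpace ℝ (Fin n)) :
    Integrable (fun z => g z * scaleKernel θ t x z) volume := by
  simp only [scaleKernel_eq_dilateAt ht, mul_left_comm (g _)]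
  exact (h.2 (dilateAt θ (inv_pos.2 ht).ne' x)).1.const_mul _

lemma scaleKernel_half_sub
    (hχθ : ∀ w, fracDerivSchwartz s θ w = (2 : ℂ) ^ n * χ ((2 : ℝ) • w) - χ w)
    {t : ℝ} (ht : 0 < t) (x z : EuclideanSpace ℝ (Fin n)) :
    scaleKernel χ (t / 2) x z - scaleKernel χ t x z =
      (((t ^ n)⁻¹ * t ^ s : ℝ) : ℂ) * fracDerivSchwartz s (dilateAt θ (inv_pos.2 ht).ne' x) z := by
  have ht' : (t : ℂ) ≠ 0 := Complex.ofReal_ne_zero.2 ht.ne'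
  have hhalf : 2 * t⁻¹ = (t / 2)⁻¹ := by
    rw [inv_div]
    rfl
  rw [fracDerivSchwartz_dilateAt s θ (inv_pos.2 ht), hχθ, smul_smul, hhalf, Real.inv_rpow ht.le,
    ← mul_assoc, ← Complex.ofReal_mul, mul_inv_cancel_right₀ (Real.rpow_pos_of_pos ht s).ne',
    scaleKernel, scaleKernel, finrank_euclideanSpace_fin, Complex.real_smul, Complex.real_smul]
  push_cast
  rw [div_pow]
  field_simp

lemma HasFracDeriv.scaleMean_sub (h : HasFracDeriv s u g) (hs : s ≤ 1)
    (hχθ : ∀ w, fracDerivSchwartz s θ w = (2 : ℂ) ^ n * χ ((2 : ℝ) • w) - χ w)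
    {t : ℝ} (ht : 0 < t) (x : EuclideanSpace ℝ (Fin n)) :
    scaleMean volume χ u (t / 2) x - scaleMean volume χ u t x =
      ((t ^ s : ℝ) : ℂ) * scaleMean volume θ g t x := by
  have hu := (locallyIntegrable_of_integrable_rpow_mul h.1).aestronglyMeasurable
  unfold scaleMean
  rw [← integral_sub (integrable_mul_scaleKernel χ hu (half_pos ht)
      (h.poissonMean_enorm_ne_top hs (half_pos ht) x))
    (integrable_mul_scaleKernel χ hu ht (h.poissonMean_enorm_ne_top hs ht x))]
  simp only [← mul_sub, scaleKernel_half_sub hχθ ht]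
  simp only [scaleKernel_eq_dilateAt ht, mul_left_comm _ (Complex.ofReal _)]
  rw [integral_const_mul, integral_const_mul, (h.2 _).2]
  push_cast
  ring

lemma exists_enorm_scaleMean_half_sub_le (hs : s ≤ 1)
    (hχθ : ∀ w, fracDerivSchwartz s θ w = (2 : ℂ) ^ n * χ ((2 : ℝ) • w) - χ w) :
    ∃ C : ℝ≥0, ∀ u g, HasFracDeriv s u g → AEStronglyMeasurable g volume → ∀ t, 0 < t → ∀ x,
      ‖scaleMean volume χ u (t / 2) x - scaleMean volume χ u t x‖ₑ ≤
        C * ENNReal.ofReal (t ^ s) * maximalFn volume (fun z => ‖g z‖ₑ) x := by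
  obtain ⟨B, hB⟩ := exists_enorm_scaleMean_le (μ := volume) θ
  obtain ⟨C, hC⟩ := exists_poissonMean_le_maximalFn (volume : Measure (EuclideanSpace ℝ (Fin n)))
  refine ⟨B * C, fun u g h hg t ht x => ?_⟩
  rw [h.scaleMean_sub hs hχθ ht x, enorm_mul, ← ofReal_norm, Complex.norm_real,
    Real.norm_of_nonneg (by positivity), ENNReal.coe_mul]
  calc ENNReal.ofReal (t ^ s) * ‖scaleMean volume θ g t x‖ₑ
      ≤ ENNReal.ofReal (t ^ s) * (B * (C * maximalFn volume (fun z => ‖g z‖ₑ) x)) := by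
        gcongr
        exact (hB g t ht x).trans (mul_le_mul_right (hC _ hg.enorm t ht x) _)
    _ = B * C * ENNReal.ofReal (t ^ s) * maximalFn volume (fun z => ‖g z‖ₑ) x := by ring

lemma exists_enorm_scaleMean_half_sub_sub_le (hs : s ≤ 1)
    (hχθ : ∀ w, fracDerivSchwartz s θ w = (2 : ℂ) ^ n * χ ((2 : ℝ) • w) - χ w) :
    ∃ C : ℝ≥0, ∀ u g, HasFracDeriv s u g → AEStronglyMeasurable g volume → ∀ t, 0 < t →
      ∀ x y, ‖x - y‖ ≤ t →
        ‖(scaleMean volume χ u (t / 2) x - scaleMean volume χ u (t / 2) y) -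
          (scaleMean volume χ u t x - scaleMean volume χ u t y)‖ₑ ≤
          C * ENNReal.ofReal (‖x - y‖ * t ^ (s - 1)) *
            maximalFn volume (fun z => ‖g z‖ₑ) x := by
  obtain ⟨B, hB⟩ := exists_enorm_scaleMean_sub_le (μ := volume) θ
  obtain ⟨C, hC⟩ := exists_poissonMean_le_maximalFn (volume : Measure (EuclideanSpace ℝ (Fin n)))
  refine ⟨B * C, fun u g h hg t ht x y hxy => ?_⟩
  have hpow : t ^ s * (‖x - y‖ / t) = ‖x - y‖ * t ^ (s - 1) := by
    rw [Real.rpow_sub_one ht.ne']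
    ring
  rw [sub_sub_sub_comm, h.scaleMean_sub hs hχθ ht x, h.scaleMean_sub hs hχθ ht y, ← mul_sub,
    enorm_mul, ← ofReal_norm, Complex.norm_real, Real.norm_of_nonneg (by positivity),
    ENNReal.coe_mul, ← hpow, ENNReal.ofReal_mul (by positivity)]
  calc ENNReal.ofReal (t ^ s) * ‖scaleMean volume θ g t x - scaleMean volume θ g t y‖ₑ
      ≤ ENNReal.ofReal (t ^ s) * (B * ENNReal.ofReal (‖x - y‖ / t) *
          (C * maximalFn volume (fun z => ‖g z‖ₑ) x)) := by
        gcongr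
        exact (hB g t ht (h.integrable_deriv_mul_scaleKernel θ ht) x y hxy).trans
          (mul_le_mul_right (hC _ hg.enorm t ht x) _)
    _ = B * C * (ENNReal.ofReal (t ^ s) * ENNReal.ofReal (‖x - y‖ / t)) *
          maximalFn volume (fun z => ‖g z‖ₑ) x := by ring

lemma coe_mul_div_one_sub_ofReal {q : ℝ} (hq0 : 0 ≤ q) (hq : q < 1) (C : ℝ≥0) (a : ℝ≥0∞) :
    C * a / (1 - ENNReal.ofReal q) = (C / (1 - q).toNNReal : ℝ≥0) * a := by
  rw [ENNReal.coe_div (Real.toNNReal_pos.2 (sub_pos.2 hq)).ne', ← ENNReal.ofReal_one,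
    ← ENNReal.ofReal_sub _ hq0, ENNReal.div_eq_inv_mul, ENNReal.div_eq_inv_mul, mul_assoc]
  rfl

/-- Telescoping over the scales `r, r / 2, r / 4, …`. -/
lemma exists_enorm_scaleMean_sub_self_le (hs0 : 0 < s) (hs1 : s ≤ 1) (hχ : ∫ z, χ z = 1)
    (hχθ : ∀ w, fracDerivSchwartz s θ w = (2 : ℂ) ^ n * χ ((2 : ℝ) • w) - χ w) :
    ∃ C : ℝ≥0, ∀ u g, HasFracDeriv s u g → AEStronglyMeasurable g volume → ∀ r, 0 < r →
      ∀ x, IsLebesguePoint volume u x → ‖scaleMean volume χ u r x - u x‖ₑ ≤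
        C * (ENNReal.ofReal (r ^ s) * maximalFn volume (fun z => ‖g z‖ₑ) x) := by
  obtain ⟨C, hC⟩ := exists_enorm_scaleMean_half_sub_le hs1 hχθ
  set q : ℝ := 2⁻¹ ^ s
  have hq : q < 1 := Real.rpow_lt_one (by norm_num) (by norm_num) hs0
  refine ⟨C / (1 - q).toNNReal, fun u g h hg r hr x hx => ?_⟩
  set M := maximalFn volume (fun z => ‖g z‖ₑ) x
  have hu := (locallyIntegrable_of_integrable_rpow_mul h.1).aestronglyMeasurable
  have hscale : Tendsto (fun j : ℕ => r * 2⁻¹ ^ j) atTop (𝓝[>] 0) := by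
    refine tendsto_nhdsWithin_iff.2 ⟨?_, .of_forall fun j => mem_Ioi.2 (by positivity)⟩
    simpa using (tendsto_pow_atTop_nhds_zero_of_lt_one (r := (2⁻¹ : ℝ)) (by norm_num)
      (by norm_num)).const_mul r
  have hlim := (hx.tendsto_scaleMean hu (fun t ht => h.poissonMean_enorm_ne_top hs1 ht x) hχ).comp
    hscale
  have hstep (j : ℕ) : edist (scaleMean volume χ u (r * 2⁻¹ ^ j) x)
      (scaleMean volume χ u (r * 2⁻¹ ^ (j + 1)) x) ≤
        C * (ENNReal.ofReal (r ^ s) * M) * ENNReal.ofReal q ^ j := by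
    have hrj : r * 2⁻¹ ^ (j + 1) = r * 2⁻¹ ^ j / 2 := by ring
    have hpow : (r * 2⁻¹ ^ j) ^ s = r ^ s * q ^ j := by
      rw [Real.mul_rpow hr.le (by positivity), ← Real.rpow_natCast_mul (by norm_num),
        ← Real.rpow_mul_natCast (by norm_num), mul_comm s]
    rw [edist_comm, edist_eq_enorm_sub, hrj]
    refine (hC u g h hg (r * 2⁻¹ ^ j) (by positivity) x).trans_eq ?_
    rw [hpow, ENNReal.ofReal_mul (by positivity), ENNReal.ofReal_pow (by positivity)]
    ring
  have hsum := edist_le_of_edist_le_geometric_of_tendsto₀ _ _ hstep hlim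
  simpa [edist_eq_enorm_sub, coe_mul_div_one_sub_ofReal (by positivity) hq] using hsum

/-- Telescoping over the scales `r, 2 * r, 4 * r, …`, along which the increments of the means tend
to zero. -/
lemma exists_enorm_scaleMean_sub_scaleMean_le (hs1 : s < 1)
    (hχθ : ∀ w, fracDerivSchwartz s θ w = (2 : ℂ) ^ n * χ ((2 : ℝ) • w) - χ w) :
    ∃ C : ℝ≥0, ∀ u g, HasFracDeriv s u g → AEStronglyMeasurable g volume → ∀ x y, x ≠ y →
      ‖scaleMean volume χ u ‖x - y‖ x - scaleMean volume χ u ‖x - y‖ y‖ₑ ≤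
        C * (ENNReal.ofReal (‖x - y‖ ^ s) * maximalFn volume (fun z => ‖g z‖ₑ) x) := by
  obtain ⟨C, hC⟩ := exists_enorm_scaleMean_half_sub_sub_le hs1.le hχθ
  set q : ℝ := 2 ^ (s - 1)
  have hq : q < 1 := Real.rpow_lt_one_of_one_lt_of_neg one_lt_two (by linarith)
  refine ⟨C / (1 - q).toNNReal, fun u g h hg x y hxy => ?_⟩
  set M := maximalFn volume (fun z => ‖g z‖ₑ) x
  set r := ‖x - y‖
  have hr : 0 < r := norm_pos_iff.2 (sub_ne_zero.2 hxy)
  have hu := (locallyIntegrable_of_integrable_rpow_mul h.1).aestronglyMeasurable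
  have hlim := (tendsto_scaleMean_sub_atTop χ hu
    (fun t ht => h.poissonMean_enorm_ne_top hs1.le ht) x y).comp
    ((tendsto_pow_atTop_atTop_of_one_lt (one_lt_two (α := ℝ))).const_mul_atTop hr)
  have hstep (j : ℕ) : edist
      (scaleMean volume χ u (r * 2 ^ j) x - scaleMean volume χ u (r * 2 ^ j) y)
      (scaleMean volume χ u (r * 2 ^ (j + 1)) x - scaleMean volume χ u (r * 2 ^ (j + 1)) y) ≤
        C * (ENNReal.ofReal (r ^ s) * M) * ENNReal.ofReal q ^ j := by
    have hrj : r * 2 ^ j = r * 2 ^ (j + 1) / 2 := by ring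
    have hpow : r * (r * 2 ^ (j + 1)) ^ (s - 1) ≤ r ^ s * q ^ j := by
      rw [Real.mul_rpow hr.le (by positivity), ← Real.rpow_natCast_mul zero_le_two,
        mul_comm _ (s - 1), Real.rpow_mul_natCast zero_le_two, ← mul_assoc, mul_comm r,
        ← Real.rpow_add_one hr.ne', sub_add_cancel]
      exact mul_le_mul_of_nonneg_left (pow_le_pow_of_le_one (by positivity) hq.le j.le_succ)
        (by positivity)
    rw [edist_eq_enorm_sub, hrj]
    refine (hC u g h hg (r * 2 ^ (j + 1)) (by positivity) x y
      (le_mul_of_one_le_right hr.le (one_le_pow₀ one_le_two))).trans ?_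
    calc C * ENNReal.ofReal (r * (r * 2 ^ (j + 1)) ^ (s - 1)) * M
        ≤ C * ENNReal.ofReal (r ^ s * q ^ j) * M := by gcongr
      _ = C * (ENNReal.ofReal (r ^ s) * M) * ENNReal.ofReal q ^ j := by
          rw [ENNReal.ofReal_mul (by positivity), ENNReal.ofReal_pow (by positivity)]
          ring
  have hsum := edist_le_of_edist_le_geometric_of_tendsto₀ _ _ hstep hlim
  simpa [edist_eq_enorm_sub, coe_mul_div_one_sub_ofReal (by positivity) hq] using hsum

theorem exists_enorm_sub_le_maximalFn (n : ℕ) {s : ℝ} (hs0 : 0 < s) (hs1 : s < 1) :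
    ∃ C : ℝ≥0, ∀ u g : EuclideanSpace ℝ (Fin n) → ℂ, HasFracDeriv s u g →
      AEStronglyMeasurable g volume → ∀ x y, IsLebesguePoint volume u x →
        IsLebesguePoint volume u y →
        ‖u x - u y‖ₑ ≤ C * ENNReal.ofReal (‖x - y‖ ^ s) *
          (maximalFn volume (fun z => ‖g z‖ₑ) x + maximalFn volume (fun z => ‖g z‖ₑ) y) := by
  obtain ⟨χ, θ, hχ, hχθ⟩ := exists_littlewoodPaley_kernel n s
  obtain ⟨C, hC⟩ := exists_enorm_scaleMean_sub_self_le hs0 hs1.le hχ hχθ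
  obtain ⟨D, hD⟩ := exists_enorm_scaleMean_sub_scaleMean_le hs1 hχθ
  refine ⟨C + D, fun u g h hg x y hx hy => ?_⟩
  rcases eq_or_ne x y with rfl | hxy
  · simp
  set M := maximalFn volume (fun z => ‖g z‖ₑ)
  set r := ‖x - y‖
  have hr : 0 < r := norm_pos_iff.2 (sub_ne_zero.2 hxy)
  set S := scaleMean volume χ u r
  calc ‖u x - u y‖ₑ = ‖(S y - u y) - (S x - u x) + (S x - S y)‖ₑ := by ring_nf
    _ ≤ ‖S y - u y‖ₑ + ‖S x - u x‖ₑ + ‖S x - S y‖ₑ :=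
        (enorm_add_le _ _).trans (add_le_add_left enorm_sub_le _)
    _ ≤ C * (ENNReal.ofReal (r ^ s) * M y) + C * (ENNReal.ofReal (r ^ s) * M x) +
          D * (ENNReal.ofReal (r ^ s) * (M x + M y)) := by
        gcongr
        · exact hC u g h hg r hr y hy
        · exact hC u g h hg r hr x hx
        · exact (hD u g h hg x y hxy).trans (by gcongr; exact le_self_add)
    _ = ↑(C + D) * ENNReal.ofReal (r ^ s) * (M x + M y) := by
        rw [ENNReal.coe_add]
        ring

end Hajlasz

section Kernel

variable {E : Type*} [NormedAddCommGroup E] [NormedSpace ℝ E] [FiniteDimensional ℝ E] [Nontrivial E]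
  [MeasurableSpace E] [BorelSpace E] (μ : Measure E) [μ.IsAddHaarMeasure] {σ τ : ℝ}

lemma exists_lintegral_mul_norm_sub_rpow_le (hσ : 0 < σ) (hστ : σ < τ) :
    ∃ C : ℝ≥0, ∀ F G U : E → ℝ≥0∞, AEMeasurable G μ → AEMeasurable U μ →
      ∀ (x : E) (A : ℝ), 0 < A →
      (∀ᵐ z ∂μ, ‖z - x‖ ≤ A → F z ≤ ENNReal.ofReal (‖z - x‖ ^ τ) * G z) →
      (∀ᵐ z ∂μ, A < ‖z - x‖ → F z ≤ U z) →
      ∫⁻ z, F z * ENNReal.ofReal (‖z - x‖ ^ (-(finrank ℝ E + σ))) ∂μ ≤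
        C * (ENNReal.ofReal (A ^ (τ - σ)) * maximalFn μ G x +
          ENNReal.ofReal (A ^ (-σ)) * maximalFn μ U x) := by
  obtain ⟨C₁, hC₁⟩ := exists_setLIntegral_mul_norm_rpow_le μ (sub_pos.2 hστ)
  obtain ⟨C₂, hC₂⟩ := exists_lintegral_mul_max_rpow_le μ hσ
  refine ⟨max C₁ C₂, fun F G U hG hU x A hA hnear hfar => ?_⟩
  have hball : MeasurableSet (closedBall x A) := isClosed_closedBall.measurableSet
  have hin : ∫⁻ z in closedBall x A, F z * ENNReal.ofReal (‖z - x‖ ^ (-(finrank ℝ E + σ))) ∂μ ≤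
      C₁ * ENNReal.ofReal (A ^ (τ - σ)) * maximalFn μ G x := by
    refine (setLIntegral_mono_ae' hball ?_).trans (hC₁ G hG x A hA)
    filter_upwards [hnear] with z hz hzA
    have hpow : ‖z - x‖ ^ τ * ‖z - x‖ ^ (-(finrank ℝ E + σ)) ≤
        ‖z - x‖ ^ (-(finrank ℝ E - (τ - σ))) := by
      rcases (norm_nonneg (z - x)).eq_or_lt with h | h
      · rw [← h, Real.zero_rpow (hσ.trans hστ).ne', zero_mul]
        positivity
      · rw [← Real.rpow_add h]
        exact (congrArg (‖z - x‖ ^ ·) (by ring)).le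
    calc F z * ENNReal.ofReal (‖z - x‖ ^ (-(finrank ℝ E + σ)))
        ≤ ENNReal.ofReal (‖z - x‖ ^ τ) * G z *
          ENNReal.ofReal (‖z - x‖ ^ (-(finrank ℝ E + σ))) := by
          gcongr
          exact hz (mem_closedBall_iff_norm.1 hzA)
      _ = G z * ENNReal.ofReal (‖z - x‖ ^ τ * ‖z - x‖ ^ (-(finrank ℝ E + σ))) := by
          rw [ENNReal.ofReal_mul (by positivity)]
          ring
      _ ≤ _ := by gcongr
  have hout : ∫⁻ z in (closedBall x A)ᶜ, F z * ENNReal.ofReal (‖z - x‖ ^ (-(finrank ℝ E + σ))) ∂μ ≤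
      C₂ * ENNReal.ofReal (A ^ (-σ)) * maximalFn μ U x := by
    refine ((setLIntegral_mono_ae' hball.compl ?_).trans (setLIntegral_le_lintegral _ _)).trans
      (hC₂ U hU x A hA)
    filter_upwards [hfar] with z hz hzA
    have hzA' : A < ‖z - x‖ := by
      simpa only [mem_compl_iff, mem_closedBall_iff_norm, not_le] using hzA
    rw [max_eq_left hzA'.le]
    gcongr
    exact hz hzA'
  rw [← lintegral_add_compl _ hball, mul_add, ← mul_assoc, ← mul_assoc]
  refine (add_le_add hin hout).trans ?_
  gcongr
  · exact le_max_left _ _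
  · exact le_max_right _ _

lemma exists_lintegral_mul_norm_rpow_le (hσ : 0 < σ) (hστ : σ < τ) :
    ∃ C : ℝ≥0, ∀ (F : E → ℝ≥0∞) (a b : ℝ≥0∞) (A : ℝ), 0 < A →
      (∀ y, ‖y‖ ≤ A → F y ≤ ENNReal.ofReal (‖y‖ ^ τ) * a) → (∀ y, A < ‖y‖ → F y ≤ b) →
      ∫⁻ y, F y * ENNReal.ofReal (‖y‖ ^ (-(finrank ℝ E + σ))) ∂μ ≤
        C * (ENNReal.ofReal (A ^ (τ - σ)) * a + ENNReal.ofReal (A ^ (-σ)) * b) := by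
  obtain ⟨C, hC⟩ := exists_lintegral_mul_norm_sub_rpow_le μ hσ hστ
  refine ⟨C, fun F a b A hA hnear hfar => ?_⟩
  have h := hC F (fun _ => a) (fun _ => b) aemeasurable_const aemeasurable_const 0 A hA
    (.of_forall fun y => by simpa only [sub_zero] using hnear y)
    (.of_forall fun y => by simpa only [sub_zero] using hfar y)
  simp only [sub_zero] at h
  refine h.trans ?_
  gcongr <;> exact maximalFn_le_of_ae_le (.of_forall fun _ => le_rfl) 0

lemma exists_lintegral_mul_norm_rpow_le_add (hσ : 0 < σ) (hστ : σ < τ) :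
    ∃ C : ℝ≥0, ∀ F f : E → ℝ≥0∞, AEMeasurable f μ → ∀ (a b : ℝ≥0∞) (A : ℝ), 0 < A →
      (∀ y, ‖y‖ ≤ A → F y ≤ ENNReal.ofReal (‖y‖ ^ τ) * a) → (∀ y, A < ‖y‖ → F y ≤ b + f y) →
      ∫⁻ y, F y * ENNReal.ofReal (‖y‖ ^ (-(finrank ℝ E + σ))) ∂μ ≤
        C * (ENNReal.ofReal (A ^ (τ - σ)) * a + ENNReal.ofReal (A ^ (-σ)) * b) +
          ENNReal.ofReal (A ^ (-(finrank ℝ E + σ))) * ∫⁻ y, f y ∂μ := by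
  obtain ⟨C, hC⟩ := exists_lintegral_mul_norm_rpow_le μ hσ hστ
  refine ⟨C, fun F f hf a b A hA hnear hfar => ?_⟩
  have htrunc := hC (fun y => if ‖y‖ ≤ A then F y else b) a b A hA
    (fun y hy => by simpa only [if_pos hy] using hnear y hy)
    (fun y hy => by simp only [if_neg hy.not_ge, le_rfl])
  have hsplit (y : E) : F y * ENNReal.ofReal (‖y‖ ^ (-(finrank ℝ E + σ))) ≤
      (if ‖y‖ ≤ A then F y else b) * ENNReal.ofReal (‖y‖ ^ (-(finrank ℝ E + σ))) +
        ENNReal.ofReal (A ^ (-(finrank ℝ E + σ))) * f y := by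
    split_ifs with hy
    · exact le_self_add
    · rw [not_le] at hy
      refine (mul_le_mul_left (hfar y hy) _).trans ?_
      rw [add_mul, mul_comm (f y)]
      gcongr _ + ENNReal.ofReal ?_ * _
      exact Real.rpow_le_rpow_of_nonpos hA hy.le (neg_nonpos.2 (by positivity))
  refine (lintegral_mono hsplit).trans ?_
  rw [lintegral_add_right' _ (hf.const_mul _), lintegral_const_mul' _ _ ENNReal.ofReal_ne_top]
  gcongr

end Kernel

section SingularSymbol

lemma norm_exp_ofReal_mul_I_sub_one_le_abs (t : ℝ) : ‖Complex.exp (t * Complex.I) - 1‖ ≤ |t| := by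
  simpa only [mul_comm, Real.norm_eq_abs] using Real.norm_exp_I_mul_ofReal_sub_one_le (x := t)

lemma norm_exp_ofReal_mul_I_sub_one_le_two (t : ℝ) : ‖Complex.exp (t * Complex.I) - 1‖ ≤ 2 := by
  refine (norm_sub_le _ _).trans_eq ?_
  rw [Complex.norm_exp_ofReal_mul_I, norm_one, one_add_one_eq_two]

lemma enorm_ofReal_of_nonneg {a : ℝ} (ha : 0 ≤ a) : ‖(a : ℂ)‖ₑ = ENNReal.ofReal a := by
  rw [← ofReal_norm, Complex.norm_real, Real.norm_of_nonneg ha]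

variable {n : ℕ} {σ : ℝ}

/-- The symbol of the singular integral `φ ↦ ∫ (φ (x - y) - φ x) |y|^{-n-σ} dy`; for `0 < σ < 1` it
is a negative multiple of `|ξ|^σ`. -/
noncomputable def singularSymbol (σ : ℝ) (ξ : EuclideanSpace ℝ (Fin n)) : ℂ :=
  ∫ y, (Complex.exp (↑(-2 * Real.pi * inner ℝ y ξ) * Complex.I) - 1) *
    ((‖y‖ ^ (-(n + σ) : ℝ) : ℝ) : ℂ)

lemma exists_lintegral_exp_sub_one_mul_norm_rpow_le [NeZero n] (hσ0 : 0 < σ) (hσ1 : σ < 1) :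
    ∃ C : ℝ≥0, ∀ ξ : EuclideanSpace ℝ (Fin n),
      ∫⁻ y, ‖(Complex.exp (↑(-2 * Real.pi * inner ℝ y ξ) * Complex.I) - 1) *
        ((‖y‖ ^ (-(n + σ) : ℝ) : ℝ) : ℂ)‖ₑ ≤ C * ENNReal.ofReal (2 * Real.pi * ‖ξ‖ + 2) := by
  obtain ⟨C, hC⟩ := exists_lintegral_mul_norm_rpow_le
    (volume : Measure (EuclideanSpace ℝ (Fin n))) hσ0 hσ1
  refine ⟨C, fun ξ => ?_⟩
  have h := hC (fun y => ‖Complex.exp (↑(-2 * Real.pi * inner ℝ y ξ) * Complex.I) - 1‖ₑ)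
    (ENNReal.ofReal (2 * Real.pi * ‖ξ‖)) (ENNReal.ofReal 2) 1 one_pos
    (fun y _ => ?_) (fun y _ => ?_)
  · simpa only [enorm_mul, enorm_ofReal_of_nonneg (Real.rpow_nonneg (norm_nonneg _) _),
      finrank_euclideanSpace_fin, Real.one_rpow, ENNReal.ofReal_one, one_mul,
      ← ENNReal.ofReal_add (by positivity : 0 ≤ 2 * Real.pi * ‖ξ‖) zero_le_two] using h
  · rw [← ofReal_norm, ← ENNReal.ofReal_mul (by positivity), Real.rpow_one]
    refine ENNReal.ofReal_le_ofReal ((norm_exp_ofReal_mul_I_sub_one_le_abs _).trans ?_)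
    rw [abs_mul, abs_mul, abs_neg, abs_two, abs_of_pos Real.pi_pos, mul_left_comm]
    gcongr
    exact abs_real_inner_le_norm y ξ
  · rw [← ofReal_norm]
    exact ENNReal.ofReal_le_ofReal (norm_exp_ofReal_mul_I_sub_one_le_two _)

lemma integrable_exp_sub_one_mul_norm_rpow [NeZero n] (hσ0 : 0 < σ) (hσ1 : σ < 1)
    (ξ : EuclideanSpace ℝ (Fin n)) :
    Integrable (fun y : EuclideanSpace ℝ (Fin n) =>
      (Complex.exp (↑(-2 * Real.pi * inner ℝ y ξ) * Complex.I) - 1) *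
        ((‖y‖ ^ (-(n + σ) : ℝ) : ℝ) : ℂ)) volume := by
  obtain ⟨C, hC⟩ := exists_lintegral_exp_sub_one_mul_norm_rpow_le (n := n) hσ0 hσ1
  have _hinner : Measurable fun y : EuclideanSpace ℝ (Fin n) => inner ℝ y ξ := by fun_prop
  exact ⟨by fun_prop, (hC ξ).trans_lt (by finiteness)⟩

lemma singularSymbol_map_linearIsometryEquiv (σ : ℝ)
    (T : EuclideanSpace ℝ (Fin n) ≃ₗᵢ[ℝ] EuclideanSpace ℝ (Fin n)) (ξ : EuclideanSpace ℝ (Fin n)) :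
    singularSymbol σ (T ξ) = singularSymbol σ ξ := by
  rw [singularSymbol, ← T.measurePreserving.integral_comp T.toHomeomorph.measurableEmbedding]
  simp only [T.inner_map_map, T.norm_map, singularSymbol]

lemma singularSymbol_smul (σ : ℝ) {R : ℝ} (hR : 0 < R) (ξ : EuclideanSpace ℝ (Fin n)) :
    singularSymbol σ (R • ξ) = ((R ^ σ : ℝ) : ℂ) * singularSymbol σ ξ := by
  have hscale := Measure.integral_comp_smul (volume : Measure (EuclideanSpace ℝ (Fin n)))
    (fun y => (Complex.exp (↑(-2 * Real.pi * inner ℝ y ξ) * Complex.I) - 1) *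
      ((‖y‖ ^ (-(n + σ) : ℝ) : ℝ) : ℂ)) R
  rw [finrank_euclideanSpace_fin, abs_of_pos (by positivity), Complex.real_smul] at hscale
  have hRσ : R ^ σ = R ^ (n + σ) * (R ^ n)⁻¹ := by
    rw [Real.rpow_add hR, Real.rpow_natCast, mul_right_comm, mul_inv_cancel₀ (by positivity),
      one_mul]
  have hnorm (y : EuclideanSpace ℝ (Fin n)) :
      ‖y‖ ^ (-(n + σ) : ℝ) = R ^ (n + σ) * ‖R • y‖ ^ (-(n + σ) : ℝ) := by
    rw [norm_smul, Real.norm_of_nonneg hR.le, Real.mul_rpow hR.le (norm_nonneg _), ← mul_assoc,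
      ← Real.rpow_add hR, add_neg_cancel, Real.rpow_zero, one_mul]
  rw [singularSymbol, singularSymbol, hRσ, Complex.ofReal_mul, mul_assoc, ← hscale,
    ← integral_const_mul]
  refine integral_congr_ae (.of_forall fun y => ?_)
  dsimp only
  rw [hnorm y, real_inner_smul_left, real_inner_smul_right, Complex.ofReal_mul (R ^ _),
    mul_left_comm]

lemma singularSymbol_eq (hσ : σ ≠ 0) {e : EuclideanSpace ℝ (Fin n)} (he : ‖e‖ = 1)
    (ξ : EuclideanSpace ℝ (Fin n)) :
    singularSymbol σ ξ = ((‖ξ‖ ^ σ : ℝ) : ℂ) * singularSymbol σ e := by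
  rcases eq_or_ne ξ 0 with rfl | hξ
  · simp [singularSymbol, Real.zero_rpow hσ]
  have hpos : 0 < ‖ξ‖ := norm_pos_iff.2 hξ
  have hunit : ‖e‖ = ‖‖ξ‖⁻¹ • ξ‖ := by
    rw [norm_smul, norm_inv, norm_norm, inv_mul_cancel₀ hpos.ne', he]
  -- The reflection exchanging the unit vectors `e` and `ξ / ‖ξ‖` preserves the symbol.
  have hrefl : singularSymbol σ (‖ξ‖⁻¹ • ξ) = singularSymbol σ e := by
    rw [← Submodule.reflection_sub hunit, singularSymbol_map_linearIsometryEquiv]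
  rw [← hrefl, ← singularSymbol_smul σ hpos, smul_inv_smul₀ hpos.ne']

lemma re_exp_sub_one_mul_norm_rpow (y ξ : EuclideanSpace ℝ (Fin n)) :
    ((Complex.exp (↑(-2 * Real.pi * inner ℝ y ξ) * Complex.I) - 1) *
      ((‖y‖ ^ (-(n + σ) : ℝ) : ℝ) : ℂ)).re =
    -((1 - Real.cos (2 * Real.pi * inner ℝ y ξ)) * ‖y‖ ^ (-(n + σ) : ℝ)) := by
  rw [Complex.re_mul_ofReal, Complex.sub_re, Complex.one_re, Complex.exp_ofReal_mul_I_re, neg_mul,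
    neg_mul, Real.cos_neg]
  ring

lemma integral_one_sub_cos_mul_norm_rpow_pos {e : EuclideanSpace ℝ (Fin n)} (he : ‖e‖ = 1)
    (hint : Integrable (fun y : EuclideanSpace ℝ (Fin n) =>
      (1 - Real.cos (2 * Real.pi * inner ℝ y e)) * ‖y‖ ^ (-(n + σ) : ℝ)) volume) :
    0 < ∫ y : EuclideanSpace ℝ (Fin n),
      (1 - Real.cos (2 * Real.pi * inner ℝ y e)) * ‖y‖ ^ (-(n + σ) : ℝ) := by
  rw [integral_pos_iff_support_of_nonneg
    (fun y => mul_nonneg (sub_nonneg.2 (Real.cos_le_one _)) (by positivity)) hint]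
  have hopen : IsOpen {y : EuclideanSpace ℝ (Fin n) | Real.cos (2 * Real.pi * inner ℝ y e) < 0} :=
    isOpen_lt (by fun_prop) continuous_const
  have hhalf : Real.cos (2 * Real.pi * inner ℝ ((1 / 2 : ℝ) • e) e) < 0 := by
    rw [real_inner_smul_left, real_inner_self_eq_norm_sq, he,
      show 2 * Real.pi * (1 / 2 * 1 ^ 2) = Real.pi by ring, Real.cos_pi]
    exact neg_one_lt_zero
  refine (hopen.measure_pos volume ⟨_, hhalf⟩).trans_le (measure_mono fun y hy => ?_)
  have hcos : Real.cos (2 * Real.pi * inner ℝ y e) < 0 := hy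
  have hy0 : y ≠ 0 := by
    rintro rfl
    rw [inner_zero_left, mul_zero, Real.cos_zero] at hcos
    linarith
  exact mul_ne_zero (by linarith) (Real.rpow_pos_of_pos (norm_pos_iff.2 hy0) _).ne'

lemma singularSymbol_ne_zero [NeZero n] (hσ0 : 0 < σ) (hσ1 : σ < 1)
    {e : EuclideanSpace ℝ (Fin n)} (he : ‖e‖ = 1) : singularSymbol σ e ≠ 0 := by
  have hint := integrable_exp_sub_one_mul_norm_rpow hσ0 hσ1 e
  have hre : (singularSymbol σ e).re = -∫ y : EuclideanSpace ℝ (Fin n),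
      (1 - Real.cos (2 * Real.pi * inner ℝ y e)) * ‖y‖ ^ (-(n + σ) : ℝ) := by
    rw [singularSymbol, ← integral_neg, ← RCLike.re_eq_complex_re, ← integral_re hint]
    exact integral_congr_ae (.of_forall fun y => re_exp_sub_one_mul_norm_rpow y e)
  have hpos := integral_one_sub_cos_mul_norm_rpow_pos (σ := σ) he
    (hint.re.neg.congr (.of_forall fun y => by
      simp only [Pi.neg_apply, RCLike.re_eq_complex_re, re_exp_sub_one_mul_norm_rpow, neg_neg]))
  intro h0
  rw [h0, Complex.zero_re] at hre
  linarith

end SingularSymbol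

section SchwartzIncrements

variable {E F : Type*} [NormedAddCommGroup E] [NormedSpace ℝ E] [NormedAddCommGroup F]
  [NormedSpace ℝ F]

lemma exists_norm_schwartz_sub_le_of_norm_le_half (φ : 𝓢(E, F)) (N : ℕ) :
    ∃ B : ℝ≥0, ∀ x y, ‖y‖ ≤ (1 + ‖x‖) / 2 →
      ‖φ (x - y) - φ x‖ ≤ B * ‖y‖ * (((1 + ‖x‖) / 2) ^ N)⁻¹ := by
  obtain ⟨B₁, hB₁⟩ := exists_norm_schwartz_le φ N
  obtain ⟨B₂, hB₂⟩ := exists_norm_schwartz_sub_le φ N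
  refine ⟨B₂ + 2 * B₁, fun x y hy => ?_⟩
  have hpow {v : ℝ} (hv : (1 + ‖x‖) / 2 ≤ v) : (v ^ N)⁻¹ ≤ (((1 + ‖x‖) / 2) ^ N)⁻¹ := by gcongr
  have hx := hpow (half_le_self (by positivity))
  push_cast
  rcases le_total ‖y‖ 1 with hy1 | hy1
  · have hshort := hB₂ x (x - y) (by simpa only [sub_sub_cancel_left, norm_neg] using hy1)
    rw [sub_sub_cancel_left, norm_neg] at hshort
    refine hshort.trans ?_
    gcongr
    exact le_add_of_nonneg_right (by positivity)
  · have hxy := hpow (v := 1 + ‖x - y‖) (by linarith [norm_sub_norm_le x y])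
    calc ‖φ (x - y) - φ x‖ ≤ ‖φ (x - y)‖ + ‖φ x‖ := norm_sub_le _ _
      _ ≤ B₁ * ((1 + ‖x - y‖) ^ N)⁻¹ + B₁ * ((1 + ‖x‖) ^ N)⁻¹ := add_le_add (hB₁ _) (hB₁ _)
      _ ≤ B₁ * (((1 + ‖x‖) / 2) ^ N)⁻¹ + B₁ * (((1 + ‖x‖) / 2) ^ N)⁻¹ := by gcongr
      _ = 2 * B₁ * 1 * (((1 + ‖x‖) / 2) ^ N)⁻¹ := by ring
      _ ≤ _ := by
        gcongr
        exact le_add_of_nonneg_left B₂.coe_nonneg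

end SchwartzIncrements

section SingularIntegral

variable {n : ℕ} {σ : ℝ}

lemma lintegral_enorm_schwartz_mul_one_add_norm_ne_top (φ : 𝓢(EuclideanSpace ℝ (Fin n), ℂ)) :
    ∫⁻ ξ, ‖φ ξ‖ₑ * ENNReal.ofReal (1 + ‖ξ‖) ≠ ∞ := by
  have hint := (φ.integrable_pow_mul volume 0).add (φ.integrable_pow_mul volume 1)
  convert hint.2.ne using 3 with ξ
  rw [← ofReal_norm, ← ofReal_norm, ← ENNReal.ofReal_mul (norm_nonneg _), Pi.add_apply,
    Real.norm_of_nonneg (by positivity)]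
  ring_nf

lemma schwartz_sub_sub_eq_integral (φ : 𝓢(EuclideanSpace ℝ (Fin n), ℂ))
    (x y : EuclideanSpace ℝ (Fin n)) :
    φ (x - y) - φ x = ∫ ξ, Complex.exp (↑(2 * Real.pi * inner ℝ ξ x) * Complex.I) * 𝓕 φ ξ *
      (Complex.exp (↑(-2 * Real.pi * inner ℝ y ξ) * Complex.I) - 1) := by
  have hinv (z : EuclideanSpace ℝ (Fin n)) :
      φ z = ∫ ξ, Complex.exp (↑(2 * Real.pi * inner ℝ ξ z) * Complex.I) * 𝓕 φ ξ := by
    conv_lhs =>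
      rw [← FourierTransform.fourierInv_fourier_eq (F := 𝓢(EuclideanSpace ℝ (Fin n), ℂ)) φ]
    rw [SchwartzMap.fourierInv_coe, Real.fourierInv_eq']
    rfl
  have hint (z : EuclideanSpace ℝ (Fin n)) : Integrable
      (fun ξ => Complex.exp (↑(2 * Real.pi * inner ℝ ξ z) * Complex.I) * 𝓕 φ ξ) volume := by
    refine (𝓕 φ).integrable.bdd_mul (c := 1) (Continuous.aestronglyMeasurable (by fun_prop))
      (.of_forall fun ξ => ?_)
    rw [Complex.norm_exp_ofReal_mul_I]
  rw [hinv (x - y), hinv x, ← integral_sub (hint _) (hint _)]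
  refine integral_congr_ae (.of_forall fun ξ => ?_)
  have hexp : Complex.exp (↑(2 * Real.pi * inner ℝ ξ (x - y)) * Complex.I) =
      Complex.exp (↑(2 * Real.pi * inner ℝ ξ x) * Complex.I) *
        Complex.exp (↑(-2 * Real.pi * inner ℝ y ξ) * Complex.I) := by
    rw [← Complex.exp_add, inner_sub_right, real_inner_comm y ξ]
    congr 1
    push_cast
    ring
  dsimp only
  rw [hexp]
  ring

lemma integrable_prod_mul_exp_sub_one_mul_norm_rpow [NeZero n] (hσ0 : 0 < σ) (hσ1 : σ < 1)
    {m : EuclideanSpace ℝ (Fin n) → ℂ} (hm : Measurable m)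
    (hfin : ∫⁻ ξ, ‖m ξ‖ₑ * ENNReal.ofReal (1 + ‖ξ‖) ≠ ∞) :
    Integrable (fun z : EuclideanSpace ℝ (Fin n) × EuclideanSpace ℝ (Fin n) => m z.1 *
      ((Complex.exp (↑(-2 * Real.pi * inner ℝ z.2 z.1) * Complex.I) - 1) *
        ((‖z.2‖ ^ (-(n + σ) : ℝ) : ℝ) : ℂ))) (volume.prod volume) := by
  obtain ⟨C, hC⟩ := exists_lintegral_exp_sub_one_mul_norm_rpow_le (n := n) hσ0 hσ1
  have _hinner : Measurable fun z : EuclideanSpace ℝ (Fin n) × EuclideanSpace ℝ (Fin n) =>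
    inner ℝ z.2 z.1 := by fun_prop
  have hmeas : Measurable fun z : EuclideanSpace ℝ (Fin n) × EuclideanSpace ℝ (Fin n) => m z.1 *
      ((Complex.exp (↑(-2 * Real.pi * inner ℝ z.2 z.1) * Complex.I) - 1) *
        ((‖z.2‖ ^ (-(n + σ) : ℝ) : ℝ) : ℂ)) := by fun_prop
  refine ⟨hmeas.aestronglyMeasurable, ?_⟩
  rw [HasFiniteIntegral, lintegral_prod _ hmeas.enorm.aemeasurable]
  refine lt_of_le_of_lt ?_ (ENNReal.mul_lt_top (a := C * ENNReal.ofReal (2 * Real.pi + 2))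
    (by finiteness) hfin.lt_top)
  rw [← lintegral_const_mul' _ _ (by finiteness)]
  refine lintegral_mono fun ξ => ?_
  simp only [enorm_mul (m ξ)]
  rw [lintegral_const_mul' _ _ enorm_ne_top, mul_left_comm, mul_assoc (C : ℝ≥0∞),
    ← ENNReal.ofReal_mul (by positivity)]
  gcongr
  refine (hC ξ).trans ?_
  gcongr
  nlinarith [norm_nonneg ξ, Real.pi_pos]

/-- Expanding `φ (x - y) - φ x` by Fourier inversion, the singular integral acts on frequencies as
multiplication by its symbol. -/
lemma integral_sub_mul_norm_rpow_eq [NeZero n] (hσ0 : 0 < σ) (hσ1 : σ < 1)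
    {e : EuclideanSpace ℝ (Fin n)} (he : ‖e‖ = 1) (φ : 𝓢(EuclideanSpace ℝ (Fin n), ℂ))
    (x : EuclideanSpace ℝ (Fin n)) :
    ∫ y, (φ (x - y) - φ x) * ((‖y‖ ^ (-(n + σ) : ℝ) : ℝ) : ℂ) =
      singularSymbol σ e * fracDerivSchwartz σ φ x := by
  have hexp (ξ : EuclideanSpace ℝ (Fin n)) :
      ‖Complex.exp (↑(2 * Real.pi * inner ℝ ξ x) * Complex.I) * 𝓕 φ ξ‖ₑ = ‖𝓕 φ ξ‖ₑ := by
    rw [enorm_mul, ← ofReal_norm (Complex.exp _), Complex.norm_exp_ofReal_mul_I,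
      ENNReal.ofReal_one, one_mul]
  have hint := integrable_prod_mul_exp_sub_one_mul_norm_rpow hσ0 hσ1
    (m := fun ξ => Complex.exp (↑(2 * Real.pi * inner ℝ ξ x) * Complex.I) * 𝓕 φ ξ)
    (Continuous.measurable (by fun_prop))
    (by simpa only [hexp] using lintegral_enorm_schwartz_mul_one_add_norm_ne_top (𝓕 φ))
  simp_rw [schwartz_sub_sub_eq_integral φ x, ← integral_mul_const, mul_assoc _ (_ - _)]
  rw [← integral_integral_swap hint]
  have hsymbol (ξ : EuclideanSpace ℝ (Fin n)) :
      ∫ y, (Complex.exp (↑(-2 * Real.pi * inner ℝ y ξ) * Complex.I) - 1) *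
        ((‖y‖ ^ (-(n + σ) : ℝ) : ℝ) : ℂ) = ((‖ξ‖ ^ σ : ℝ) : ℂ) * singularSymbol σ e :=
    singularSymbol_eq hσ0.ne' he ξ
  simp_rw [integral_const_mul, hsymbol]
  rw [fracDerivSchwartz, Real.fourierInv_eq', ← integral_const_mul]
  refine integral_congr_ae (.of_forall fun ξ => ?_)
  simp only [smul_eq_mul, SchwartzMap.fourier_coe]
  ring

lemma mul_ofReal_rpow_add_le (C B₁ B₂ I : ℝ≥0) {A : ℝ} (hσ1 : σ < 1) (hA : 1 / 2 ≤ A) :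
    C * (ENNReal.ofReal (A ^ (1 - σ)) * ENNReal.ofReal (B₂ * (A ^ (n + 1))⁻¹) +
        ENNReal.ofReal (A ^ (-σ)) * ENNReal.ofReal (B₁ * (A ^ (n + 1))⁻¹)) +
        ENNReal.ofReal (A ^ (-(n + σ))) * I ≤
      ((C * (B₂ + 2 * B₁) + I : ℝ≥0) : ℝ≥0∞) * ENNReal.ofReal (A ^ (-(n + σ))) := by
  have hA0 : 0 < A := by linarith
  have hpow : A ^ (1 - σ) * (A ^ (n + 1))⁻¹ = A ^ (-(n + σ)) := by
    rw [← Real.rpow_natCast, ← Real.rpow_neg hA0.le, ← Real.rpow_add hA0]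
    push_cast
    ring_nf
  have hneg : A ^ (-σ) ≤ 2 * A ^ (1 - σ) := by
    rw [sub_eq_add_neg, Real.rpow_one_add' hA0.le (by linarith), ← mul_assoc]
    exact le_mul_of_one_le_left (by positivity) (by linarith)
  calc _ ≤ C * (ENNReal.ofReal (A ^ (1 - σ)) * ENNReal.ofReal (B₂ * (A ^ (n + 1))⁻¹) +
        ENNReal.ofReal (2 * A ^ (1 - σ)) * ENNReal.ofReal (B₁ * (A ^ (n + 1))⁻¹)) +
        ENNReal.ofReal (A ^ (-(n + σ))) * I := by gcongr
    _ = _ := by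
        rw [← hpow]
        simp only [← ENNReal.ofReal_coe_nnreal]
        rw [← ENNReal.ofReal_mul (by positivity), ← ENNReal.ofReal_mul (by positivity),
          ← ENNReal.ofReal_add (by positivity) (by positivity),
          ← ENNReal.ofReal_mul (by positivity), ← ENNReal.ofReal_mul (by positivity),
          ← ENNReal.ofReal_add (by positivity) (by positivity),
          ← ENNReal.ofReal_mul (by positivity)]
        push_cast
        ring_nf

lemma exists_lintegral_sub_mul_norm_rpow_le [NeZero n] (hσ0 : 0 < σ) (hσ1 : σ < 1)
    (φ : 𝓢(EuclideanSpace ℝ (Fin n), ℂ)) :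
    ∃ C : ℝ≥0, ∀ x, ∫⁻ y, ‖φ (x - y) - φ x‖ₑ * ENNReal.ofReal (‖y‖ ^ (-(n + σ) : ℝ)) ≤
      C * ENNReal.ofReal ((1 + ‖x‖) ^ (-(n + σ) : ℝ)) := by
  obtain ⟨C, hC⟩ := exists_lintegral_mul_norm_rpow_le_add
    (volume : Measure (EuclideanSpace ℝ (Fin n))) hσ0 hσ1
  simp only [finrank_euclideanSpace_fin] at hC
  obtain ⟨B₁, hB₁⟩ := exists_norm_schwartz_le φ (n + 1)
  obtain ⟨B₂, hB₂⟩ := exists_norm_schwartz_sub_le_of_norm_le_half φ (n + 1)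
  obtain ⟨I, hI⟩ : ∃ I : ℝ≥0, (I : ℝ≥0∞) = ∫⁻ y, ‖φ y‖ₑ :=
    ⟨_, ENNReal.coe_toNNReal φ.integrable.2.ne⟩
  refine ⟨(C * (B₂ + 2 * B₁) + I) * 2 ^ (n + σ), fun x => ?_⟩
  set A := (1 + ‖x‖) / 2 with hA
  have hA0 : 0 < A := by positivity
  have hnear (y) (hy : ‖y‖ ≤ A) : ‖φ (x - y) - φ x‖ₑ ≤
      ENNReal.ofReal (‖y‖ ^ (1 : ℝ)) * ENNReal.ofReal (B₂ * (A ^ (n + 1))⁻¹) := by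
    rw [Real.rpow_one, ← ENNReal.ofReal_mul (norm_nonneg y), ← ofReal_norm]
    exact ENNReal.ofReal_le_ofReal ((hB₂ x y hy).trans_eq (by ring))
  have hfar (y) : ‖φ (x - y) - φ x‖ₑ ≤ ENNReal.ofReal (B₁ * (A ^ (n + 1))⁻¹) + ‖φ (x - y)‖ₑ := by
    rw [add_comm]
    refine enorm_sub_le.trans (add_le_add_right ?_ _)
    rw [← ofReal_norm]
    refine ENNReal.ofReal_le_ofReal ((hB₁ x).trans ?_)
    gcongr
    exact half_le_self (by positivity)
  have hscale : A ^ (-(n + σ)) = 2 ^ (n + σ) * (1 + ‖x‖) ^ (-(n + σ)) := by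
    rw [hA, Real.div_rpow (by positivity) zero_le_two, Real.rpow_neg zero_le_two, div_inv_eq_mul,
      mul_comm]
  refine (hC _ (fun y => ‖φ (x - y)‖ₑ) (by fun_prop) _ _ A hA0 hnear fun y _ => hfar y).trans ?_
  rw [lintegral_sub_left_eq_self (fun y => ‖φ y‖ₑ) x, ← hI]
  refine (mul_ofReal_rpow_add_le C B₁ B₂ I hσ1 (by linarith [norm_nonneg x])).trans_eq ?_
  rw [hscale, ENNReal.ofReal_mul (by positivity), ← mul_assoc, ENNReal.coe_mul]
  congr 2
  rw [← ENNReal.ofReal_coe_nnreal]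
  push_cast
  rfl

end SingularIntegral

section Duality

variable {n : ℕ} {σ : ℝ} {f : EuclideanSpace ℝ (Fin n) → ℂ}

/-- The integrated increments `∫ |f(x + y) - f(x)| |y|^(-n-σ) dy`. They dominate the singular
integral that represents `|∇|^σ f`. -/
noncomputable def incrementIntegral (σ : ℝ) (f : EuclideanSpace ℝ (Fin n) → ℂ)
    (x : EuclideanSpace ℝ (Fin n)) : ℝ≥0∞ :=
  ∫⁻ y, ‖f (x + y) - f x‖ₑ * ENNReal.ofReal (‖y‖ ^ (-(n + σ) : ℝ))

lemma incrementIntegral_eq_lintegral_enorm (x : EuclideanSpace ℝ (Fin n)) :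
    incrementIntegral σ f x =
      ∫⁻ y, ‖(f (x + y) - f x) * ((‖y‖ ^ (-(n + σ) : ℝ) : ℝ) : ℂ)‖ₑ := by
  simp only [incrementIntegral, enorm_mul,
    enorm_ofReal_of_nonneg (Real.rpow_nonneg (norm_nonneg _) _)]

lemma aestronglyMeasurable_comp_add (hf : AEStronglyMeasurable f volume) :
    AEStronglyMeasurable
      (fun z : EuclideanSpace ℝ (Fin n) × EuclideanSpace ℝ (Fin n) => f (z.1 + z.2))
      (volume.prod volume) :=
  hf.comp_snd.comp_measurePreserving (measurePreserving_prod_add volume volume)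

lemma aestronglyMeasurable_increment_mul (hf : AEStronglyMeasurable f volume) :
    AEStronglyMeasurable (fun z : EuclideanSpace ℝ (Fin n) × EuclideanSpace ℝ (Fin n) =>
      (f (z.1 + z.2) - f z.1) * ((‖z.2‖ ^ (-(n + σ) : ℝ) : ℝ) : ℂ)) (volume.prod volume) :=
  ((aestronglyMeasurable_comp_add hf).sub hf.comp_fst).mul
    (Measurable.aestronglyMeasurable (by fun_prop))

lemma integrable_prod_increment_mul (hf : AEStronglyMeasurable f volume)
    (φ : 𝓢(EuclideanSpace ℝ (Fin n), ℂ))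
    (hfin : ∫⁻ x, incrementIntegral σ f x * ‖φ x‖ₑ ≠ ∞) :
    Integrable (fun z : EuclideanSpace ℝ (Fin n) × EuclideanSpace ℝ (Fin n) =>
      (f (z.1 + z.2) - f z.1) * ((‖z.2‖ ^ (-(n + σ) : ℝ) : ℝ) : ℂ) * φ z.1)
      (volume.prod volume) := by
  have hmeas : AEStronglyMeasurable (fun z : EuclideanSpace ℝ (Fin n) × EuclideanSpace ℝ (Fin n) =>
      (f (z.1 + z.2) - f z.1) * ((‖z.2‖ ^ (-(n + σ) : ℝ) : ℝ) : ℂ) * φ z.1)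
      (volume.prod volume) :=
    (aestronglyMeasurable_increment_mul hf).mul (Continuous.aestronglyMeasurable (by fun_prop))
  refine ⟨hmeas, ?_⟩
  rw [HasFiniteIntegral, lintegral_prod _ hmeas.enorm]
  convert hfin.lt_top using 3 with x
  simp only [enorm_mul _ (φ _)]
  rw [lintegral_mul_const' _ _ enorm_ne_top, incrementIntegral_eq_lintegral_enorm]

lemma integrable_prod_mul_schwartz_increment [NeZero n] (hσ0 : 0 < σ) (hσ1 : σ < 1)
    (hf : Integrable (fun x => (((1 + ‖x‖) ^ (-(n + σ) : ℝ) : ℝ) : ℂ) * f x) volume)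
    (φ : 𝓢(EuclideanSpace ℝ (Fin n), ℂ)) :
    Integrable (fun z : EuclideanSpace ℝ (Fin n) × EuclideanSpace ℝ (Fin n) =>
      f z.1 * ((φ (z.1 - z.2) - φ z.1) * ((‖z.2‖ ^ (-(n + σ) : ℝ) : ℝ) : ℂ)))
      (volume.prod volume) := by
  have hmeas : AEStronglyMeasurable (fun z : EuclideanSpace ℝ (Fin n) × EuclideanSpace ℝ (Fin n) =>
      f z.1 * ((φ (z.1 - z.2) - φ z.1) * ((‖z.2‖ ^ (-(n + σ) : ℝ) : ℝ) : ℂ)))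
      (volume.prod volume) :=
    (locallyIntegrable_of_integrable_rpow_mul hf).aestronglyMeasurable.comp_fst.mul
      (Measurable.aestronglyMeasurable (by fun_prop))
  obtain ⟨C, hC⟩ := exists_lintegral_sub_mul_norm_rpow_le hσ0 hσ1 φ
  refine ⟨hmeas, ?_⟩
  rw [HasFiniteIntegral, lintegral_prod _ hmeas.enorm]
  refine lt_of_le_of_lt ?_ (ENNReal.mul_lt_top (a := C) ENNReal.coe_lt_top
    (lintegral_enorm_mul_rpow_ne_top hf).lt_top)
  rw [← lintegral_const_mul' _ _ ENNReal.coe_ne_top]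
  refine lintegral_mono fun x => ?_
  simp only [enorm_mul, enorm_ofReal_of_nonneg (Real.rpow_nonneg (norm_nonneg _) _)]
  rw [lintegral_const_mul' _ _ enorm_ne_top, mul_left_comm]
  gcongr
  exact hC x

lemma integrable_mul_schwartz_sub (hσ1 : σ ≤ 1)
    (hf : Integrable (fun x => (((1 + ‖x‖) ^ (-(n + σ) : ℝ) : ℝ) : ℂ) * f x) volume)
    (φ : 𝓢(EuclideanSpace ℝ (Fin n), ℂ)) (y : EuclideanSpace ℝ (Fin n)) :
    Integrable (fun x => f x * φ (x - y)) volume := by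
  have hmean := poissonMean_ne_top (c := n + σ) (by rw [finrank_euclideanSpace_fin]; linarith)
    (lintegral_enorm_mul_rpow_ne_top hf) one_pos y
  simpa [scaleKernel] using integrable_mul_scaleKernel φ
    (locallyIntegrable_of_integrable_rpow_mul hf).aestronglyMeasurable one_pos hmean

lemma integral_integral_increment_mul_eq [NeZero n] (hσ0 : 0 < σ) (hσ1 : σ < 1)
    (hf : Integrable (fun x => (((1 + ‖x‖) ^ (-(n + σ) : ℝ) : ℝ) : ℂ) * f x) volume)
    (φ : 𝓢(EuclideanSpace ℝ (Fin n), ℂ))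
    (hfin : ∫⁻ x, incrementIntegral σ f x * ‖φ x‖ₑ ≠ ∞) :
    ∫ x, f x * ∫ y, (φ (x - y) - φ x) * ((‖y‖ ^ (-(n + σ) : ℝ) : ℝ) : ℂ) =
      ∫ x, (∫ y, (f (x + y) - f x) * ((‖y‖ ^ (-(n + σ) : ℝ) : ℝ) : ℂ)) * φ x := by
  have hsub (y) : Integrable (fun x => f x * φ (x - y)) volume :=
    integrable_mul_schwartz_sub hσ1.le hf φ y
  have hadd (y) : Integrable (fun x => f (x + y) * φ x) volume := by
    simpa only [add_sub_cancel_right] using (hsub y).comp_add_right y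
  have hzero : Integrable (fun x => f x * φ x) volume := by simpa only [sub_zero] using hsub 0
  have hshift (y) : ∫ x, f x * (φ (x - y) - φ x) = ∫ x, (f (x + y) - f x) * φ x := by
    simp only [mul_sub, sub_mul]
    rw [integral_sub (hsub y) hzero, integral_sub (hadd y) hzero,
      ← integral_add_right_eq_self (fun x => f x * φ (x - y)) y]
    simp only [add_sub_cancel_right]
  simp_rw [← integral_const_mul, ← integral_mul_const]
  refine (integral_integral_swap (integrable_prod_mul_schwartz_increment hσ0 hσ1 hf φ)).trans
    (Eq.trans ?_ (integral_integral_swap (integrable_prod_increment_mul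
      (locallyIntegrable_of_integrable_rpow_mul hf).aestronglyMeasurable φ hfin)).symm)
  simp_rw [← mul_assoc, mul_right_comm _ _ (φ _), integral_mul_const, hshift]

lemma exists_hasFracDeriv_singularIntegral [NeZero n] (hσ0 : 0 < σ) (hσ1 : σ < 1) :
    ∃ c : ℂ, ∀ f : EuclideanSpace ℝ (Fin n) → ℂ,
      Integrable (fun x => (((1 + ‖x‖) ^ (-(n + σ) : ℝ) : ℝ) : ℂ) * f x) volume →
      (∀ φ : 𝓢(EuclideanSpace ℝ (Fin n), ℂ), ∫⁻ x, incrementIntegral σ f x * ‖φ x‖ₑ ≠ ∞) →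
      HasFracDeriv σ f (fun x => c * ∫ y, (f (x + y) - f x) *
        ((‖y‖ ^ (-(n + σ) : ℝ) : ℝ) : ℂ)) := by
  obtain ⟨e, he⟩ := exists_norm_eq (EuclideanSpace ℝ (Fin n)) zero_le_one
  have hne := singularSymbol_ne_zero hσ0 hσ1 he
  refine ⟨(singularSymbol σ e)⁻¹, fun f hf hfin => ⟨hf, fun φ => ⟨?_, ?_⟩⟩⟩
  · have hint := integrable_prod_increment_mul
      (locallyIntegrable_of_integrable_rpow_mul hf).aestronglyMeasurable φ (hfin φ)
    refine (hint.integral_prod_left.const_mul (singularSymbol σ e)⁻¹).congr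
      (.of_forall fun x => ?_)
    dsimp only
    rw [integral_mul_const, mul_assoc]
  · simp_rw [mul_assoc]
    rw [integral_const_mul, ← integral_integral_increment_mul_eq hσ0 hσ1 hf φ (hfin φ),
      ← integral_const_mul]
    refine integral_congr_ae (.of_forall fun x => ?_)
    dsimp only
    rw [integral_sub_mul_norm_rpow_eq hσ0 hσ1 he φ x, mul_left_comm (f x), inv_mul_cancel_left₀ hne]

end Duality

section Optimization

variable {σ τ : ℝ}

lemma exists_rpow_mul_eq_rpow_mul_rpow {a b : ℝ} (ha : 0 < a) (hb : 0 < b) (hτ : τ ≠ 0) :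
    ∃ A : ℝ, 0 < A ∧ A ^ (τ - σ) * a = a ^ (σ / τ) * b ^ (1 - σ / τ) ∧
      A ^ (-σ) * b = a ^ (σ / τ) * b ^ (1 - σ / τ) := by
  have hpow (r : ℝ) : ((b / a) ^ τ⁻¹) ^ r = b ^ (r / τ) * a ^ (-(r / τ)) := by
    rw [← Real.rpow_mul (by positivity), Real.div_rpow hb.le ha.le, Real.rpow_neg ha.le,
      inv_mul_eq_div, div_eq_mul_inv]
  refine ⟨(b / a) ^ τ⁻¹, by positivity, ?_, ?_⟩
  · rw [hpow, mul_assoc, ← Real.rpow_add_one ha.ne', mul_comm, sub_div, div_self hτ]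
    ring_nf
  · rw [hpow, mul_right_comm, ← Real.rpow_add_one hb.ne', mul_comm]
    ring_nf

lemma le_two_mul_rpow_mul_rpow_of_forall_le {D c G H : ℝ≥0∞} (hσ : 0 ≤ σ) (hστ : σ < τ)
    (hc : c ≠ ∞) (hG : G ≠ ∞) (hH : H ≠ ∞)
    (h : ∀ A : ℝ, 0 < A →
      D ≤ c * (ENNReal.ofReal (A ^ (τ - σ)) * G + ENNReal.ofReal (A ^ (-σ)) * H)) :
    D ≤ 2 * c * (G ^ (σ / τ) * H ^ (1 - σ / τ)) := by
  have hτ : 0 < τ := hσ.trans_lt hστ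
  have hσ' : 0 ≤ σ / τ := by positivity
  have hτ' : 0 ≤ 1 - σ / τ := sub_nonneg.2 ((div_le_one hτ).2 hστ.le)
  -- The optimal `A` exists only for positive `G` and `H`, so both are first raised by `ε`.
  have hε (ε : ℝ≥0) (hε0 : 0 < ε) : D ≤ 2 * c * ((G + ε) ^ (σ / τ) * (H + ε) ^ (1 - σ / τ)) := by
    have hε' : (ε : ℝ≥0∞) ≠ 0 := by exact_mod_cast hε0.ne'
    have ha : 0 < (G + ε).toReal := ENNReal.toReal_pos (by simp [hε']) (by finiteness)
    have hb : 0 < (H + ε).toReal := ENNReal.toReal_pos (by simp [hε']) (by finiteness)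
    obtain ⟨A, hA, hGA, hHA⟩ := exists_rpow_mul_eq_rpow_mul_rpow (σ := σ) ha hb hτ.ne'
    calc D ≤ c * (ENNReal.ofReal (A ^ (τ - σ)) * (G + ε) +
          ENNReal.ofReal (A ^ (-σ)) * (H + ε)) := (h A hA).trans (by gcongr <;> exact le_self_add)
      _ = _ := by
        rw [← ENNReal.ofReal_toReal (a := G + ε) (by finiteness),
          ← ENNReal.ofReal_toReal (a := H + ε) (by finiteness),
          ← ENNReal.ofReal_mul (by positivity), ← ENNReal.ofReal_mul (by positivity), hGA, hHA,
          ENNReal.ofReal_mul (by positivity), ENNReal.ofReal_rpow_of_pos ha,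
          ENNReal.ofReal_rpow_of_pos hb]
        ring
  have hlim {x : ℝ≥0∞} (y : ℝ) : Tendsto (fun ε : ℝ≥0 => (x + ε) ^ y) (𝓝[>] 0) (𝓝 (x ^ y)) := by
    have : Continuous fun ε : ℝ≥0 => (x + ε) ^ y := by fun_prop
    simpa using (this.tendsto 0).mono_left nhdsWithin_le_nhds
  refine ge_of_tendsto (ENNReal.Tendsto.const_mul (ENNReal.Tendsto.mul (hlim _) (.inr ?_)
    (hlim _) (.inr ?_)) (.inr (by finiteness))) (eventually_mem_nhdsWithin.mono hε)
  · finiteness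
  · finiteness

end Optimization

section LpBounds

variable {X : Type*} [MeasurableSpace X] {μ : Measure X} {f g : X → ℝ≥0∞} {P Q R : ℝ≥0∞}

lemma ae_ne_top_of_eLpNorm_ne_top (hf : AEMeasurable f μ) (hP : P ≠ 0) (h : eLpNorm f P μ ≠ ∞) :
    ∀ᵐ x ∂μ, f x ≠ ∞ := by
  rcases eq_or_ne P ∞ with rfl | hP_top
  · rw [eLpNorm_exponent_top] at h
    exact (enorm_ae_le_eLpNormEssSup f μ).mono fun x hx => ne_top_of_le_ne_top h hx
  · have hint := (eLpNorm_lt_top_iff_lintegral_rpow_enorm_lt_top hP hP_top).1 h.lt_top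
    filter_upwards [ae_lt_top' (hf.enorm.pow_const _) hint.ne] with x hx hx_top
    rw [hx_top, enorm_eq_self, ENNReal.top_rpow_of_pos (ENNReal.toReal_pos hP hP_top)] at hx
    exact hx.ne rfl

lemma eLpNorm_ennreal_toReal (hf : ∀ᵐ x ∂μ, f x ≠ ∞) :
    eLpNorm (fun x => (f x).toReal) P μ = eLpNorm f P μ := by
  refine eLpNorm_congr_enorm_ae (hf.mono fun x hx => ?_)
  rw [enorm_eq_self, Real.enorm_of_nonneg ENNReal.toReal_nonneg, ENNReal.ofReal_toReal hx]

lemma eLpNorm_mul_le_of_inv_eq_add_inv (hf : AEMeasurable f μ) (hg : AEMeasurable g μ)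
    (hf_top : ∀ᵐ x ∂μ, f x ≠ ∞) (hg_top : ∀ᵐ x ∂μ, g x ≠ ∞) (h : R⁻¹ = P⁻¹ + Q⁻¹) :
    eLpNorm (fun x => f x * g x) R μ ≤ eLpNorm f P μ * eLpNorm g Q μ := by
  have : ENNReal.HolderTriple P Q R := ⟨h.symm⟩
  have hfg_top : ∀ᵐ x ∂μ, f x * g x ≠ ∞ := by
    filter_upwards [hf_top, hg_top] with x hx hy using ENNReal.mul_ne_top hx hy
  rw [← eLpNorm_ennreal_toReal hf_top, ← eLpNorm_ennreal_toReal hg_top,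
    ← eLpNorm_ennreal_toReal hfg_top]
  simpa only [ENNReal.toReal_mul, Pi.smul_apply', smul_eq_mul] using!
    eLpNorm_smul_le_mul_eLpNorm (p := P) (q := Q) (r := R)
      hg.ennreal_toReal.aestronglyMeasurable hf.ennreal_toReal.aestronglyMeasurable

lemma one_le_of_inv_eq_add_inv {a b : ℝ} (h : R⁻¹ = P⁻¹ + Q⁻¹) (hab : a + b = 1) (ha : 0 ≤ a)
    (hb : 0 ≤ b) (hP : 1 < P * ENNReal.ofReal a) (hQ : 1 < Q * ENNReal.ofReal b) : 1 ≤ R := by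
  rw [← ENNReal.inv_le_one, h, ← one_div, ← one_div]
  calc 1 / P + 1 / Q ≤ ENNReal.ofReal a + ENNReal.ofReal b :=
        add_le_add (ENNReal.div_le_of_le_mul' hP.le) (ENNReal.div_le_of_le_mul' hQ.le)
    _ = 1 := by rw [← ENNReal.ofReal_add ha hb, hab, ENNReal.ofReal_one]

lemma eLpNorm_le_mul_of_ae_le_mul {c : ℝ≥0} (h : ∀ᵐ x ∂μ, f x ≤ c * g x) :
    eLpNorm f P μ ≤ c * eLpNorm g P μ :=
  eLpNorm_le_nnreal_smul_eLpNorm_of_ae_le_mul' (by simpa only [enorm_eq_self] using h) P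

end LpBounds

section MaximalSum

section PseudoMetricSpace

variable {X : Type*} [PseudoMetricSpace X] [MeasurableSpace X] {μ : Measure X} {f : X → ℝ≥0∞}

variable (μ) in
/-- The sum of `f` and its maximal function: it bounds the averages of `z ↦ f z + f x` over the
balls centred at `x`. -/
noncomputable def maximalFnAddSelf (f : X → ℝ≥0∞) (x : X) : ℝ≥0∞ :=
  maximalFn μ f x + f x

lemma aemeasurable_maximalFnAddSelf [BorelSpace X] [SecondCountableTopology X] [SFinite μ]
    (hf : AEMeasurable f μ) : AEMeasurable (maximalFnAddSelf μ f) μ :=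
  measurable_maximalFn.aemeasurable.add hf

lemma maximalFn_mul_add_le_maximalFnAddSelf [ProperSpace X] [IsFiniteMeasureOnCompacts μ]
    [μ.IsOpenPosMeasure] (a : ℝ≥0) (x : X) :
    maximalFn μ (fun z => a * (f z + f x)) x ≤ a * maximalFnAddSelf μ f x := by
  rw [maximalFn_const_mul ENNReal.coe_ne_top]
  exact mul_le_mul_right (maximalFn_le_add_const fun _ => le_rfl) _

end PseudoMetricSpace

variable {E : Type*} [NormedAddCommGroup E] [NormedSpace ℝ E] [FiniteDimensional ℝ E] [Nontrivial E]
  [MeasurableSpace E] [BorelSpace E] (μ : Measure E) [μ.IsAddHaarMeasure]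

lemma exists_lintegral_mul_norm_sub_rpow_le_maximalFnAddSelf {σ τ : ℝ} (hσ : 0 < σ)
    (hστ : σ < τ) :
    ∃ C : ℝ≥0, ∀ (F G U : E → ℝ≥0∞) (a : ℝ≥0), AEMeasurable G μ → AEMeasurable U μ → ∀ x,
      (∀ᵐ z ∂μ, F z ≤ a * (ENNReal.ofReal (‖z - x‖ ^ τ) * (G z + G x))) →
      (∀ᵐ z ∂μ, F z ≤ a * (U z + U x)) →
      maximalFnAddSelf μ G x ≠ ∞ → maximalFnAddSelf μ U x ≠ ∞ →
      ∫⁻ z, F z * ENNReal.ofReal (‖z - x‖ ^ (-(finrank ℝ E + σ))) ∂μ ≤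
        C * a * (maximalFnAddSelf μ G x ^ (σ / τ) * maximalFnAddSelf μ U x ^ (1 - σ / τ)) := by
  obtain ⟨C, hC⟩ := exists_lintegral_mul_norm_sub_rpow_le μ hσ hστ
  refine ⟨2 * C, fun F G U a hG hU x hFG hFU hGx hUx => ?_⟩
  have hopt := le_two_mul_rpow_mul_rpow_of_forall_le (c := C * a) (D := ∫⁻ z, F z *
    ENNReal.ofReal (‖z - x‖ ^ (-(finrank ℝ E + σ))) ∂μ) hσ.le hστ (by finiteness) hGx hUx
    fun A hA => ?_
  · exact hopt.trans_eq (by push_cast; ring)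
  calc ∫⁻ z, F z * ENNReal.ofReal (‖z - x‖ ^ (-(finrank ℝ E + σ))) ∂μ
      ≤ C * (ENNReal.ofReal (A ^ (τ - σ)) * maximalFn μ (fun z => a * (G z + G x)) x +
        ENNReal.ofReal (A ^ (-σ)) * maximalFn μ (fun z => a * (U z + U x)) x) :=
        hC F _ _ (by fun_prop) (by fun_prop) x A hA
          (hFG.mono fun z hz _ => hz.trans_eq (mul_left_comm _ _ _)) (hFU.mono fun z hz _ => hz)
    _ ≤ C * (ENNReal.ofReal (A ^ (τ - σ)) * (a * maximalFnAddSelf μ G x) +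
        ENNReal.ofReal (A ^ (-σ)) * (a * maximalFnAddSelf μ U x)) := by
        gcongr <;> exact maximalFn_mul_add_le_maximalFnAddSelf _ _
    _ = _ := by ring

lemma exists_eLpNorm_maximalFnAddSelf_rpow_le {P : ℝ≥0∞} {α a : ℝ} (hα : 0 < α)
    (ha : 0 < a) (hP : 1 < P * ENNReal.ofReal a) :
    ∃ C : ℝ≥0, ∀ v : E → ℝ≥0∞, AEMeasurable v μ →
      eLpNorm (fun x => maximalFnAddSelf μ (fun z => v z ^ α) x ^ a) P μ ≤
        C * eLpNorm v (P * ENNReal.ofReal (α * a)) μ ^ (α * a) := by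
  obtain ⟨C, hC⟩ := exists_eLpNorm_maximalFn_le μ hP
  refine ⟨(C + 1) ^ a, fun v hv => ?_⟩
  have hvα : AEMeasurable (fun z => v z ^ α) μ := hv.pow_const α
  have hsum : eLpNorm (maximalFnAddSelf μ fun z => v z ^ α) (P * ENNReal.ofReal a) μ ≤
      (C + 1) * eLpNorm (fun z => v z ^ α) (P * ENNReal.ofReal a) μ := by
    rw [add_mul, one_mul]
    exact (eLpNorm_add_le measurable_maximalFn.aestronglyMeasurable hvα.aestronglyMeasurable
      hP.le).trans (add_le_add_left (hC _ hvα) _)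
  have houter := eLpNorm_enorm_rpow (p := P) (μ := μ) (maximalFnAddSelf μ fun z => v z ^ α) ha
  have hinner := eLpNorm_enorm_rpow (p := P * ENNReal.ofReal a) (μ := μ) v hα
  simp only [enorm_eq_self] at houter hinner
  calc eLpNorm (fun x => maximalFnAddSelf μ (fun z => v z ^ α) x ^ a) P μ
      = eLpNorm (maximalFnAddSelf μ fun z => v z ^ α) (P * ENNReal.ofReal a) μ ^ a :=
        houter
    _ ≤ ((C + 1) * eLpNorm (fun z => v z ^ α) (P * ENNReal.ofReal a) μ) ^ a := by gcongr
    _ = ((C + 1) * eLpNorm v (P * ENNReal.ofReal (α * a)) μ ^ α) ^ a := by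
        rw [hinner, mul_assoc, ← ENNReal.ofReal_mul ha.le, mul_comm a]
    _ = _ := by
        rw [ENNReal.mul_rpow_of_nonneg _ _ ha.le, ← ENNReal.rpow_mul,
          ENNReal.coe_rpow_of_nonneg _ ha.le, ENNReal.coe_add, ENNReal.coe_one]

end MaximalSum

section MaximalProduct

variable {E : Type*} [NormedAddCommGroup E] [NormedSpace ℝ E] [FiniteDimensional ℝ E] [Nontrivial E]
  [MeasurableSpace E] [BorelSpace E] {μ : Measure E} [μ.IsAddHaarMeasure] {P Q R : ℝ≥0∞}
  {α a b : ℝ}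

lemma ae_maximalFnAddSelf_ne_top (hα : 0 < α) (ha : 0 < a) (hP : 1 < P * ENNReal.ofReal a)
    {v : E → ℝ≥0∞} (hv : AEMeasurable v μ) (h : eLpNorm v (P * ENNReal.ofReal (α * a)) μ ≠ ∞) :
    ∀ᵐ x ∂μ, maximalFnAddSelf μ (fun z => v z ^ α) x ≠ ∞ := by
  obtain ⟨C, hC⟩ := exists_eLpNorm_maximalFnAddSelf_rpow_le μ hα ha hP
  have hP0 : P ≠ 0 := left_ne_zero_of_mul (one_pos.trans hP).ne'
  have hpow := ae_ne_top_of_eLpNorm_ne_top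
    ((aemeasurable_maximalFnAddSelf (hv.pow_const α)).pow_const a) hP0
    (ne_top_of_le_ne_top (by finiteness) (hC v hv))
  filter_upwards [hpow] with x hx hx_top
  exact hx (by rw [hx_top, ENNReal.top_rpow_of_pos ha])

lemma exists_eLpNorm_maximalFnAddSelf_rpow_mul_le (hα : 0 < α) (ha : 0 < a) (hb : 0 < b)
    (hP : 1 < P * ENNReal.ofReal a) (hQ : 1 < Q * ENNReal.ofReal b) (h : R⁻¹ = P⁻¹ + Q⁻¹) :
    ∃ C : ℝ≥0, ∀ v w : E → ℝ≥0∞, AEMeasurable v μ → AEMeasurable w μ →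
      eLpNorm v (P * ENNReal.ofReal (α * a)) μ ≠ ∞ →
      eLpNorm w (Q * ENNReal.ofReal (α * b)) μ ≠ ∞ →
      eLpNorm (fun x => maximalFnAddSelf μ (fun z => v z ^ α) x ^ a *
          maximalFnAddSelf μ (fun z => w z ^ α) x ^ b) R μ ≤
        C * (eLpNorm v (P * ENNReal.ofReal (α * a)) μ ^ (α * a) *
          eLpNorm w (Q * ENNReal.ofReal (α * b)) μ ^ (α * b)) := by
  obtain ⟨C₁, hC₁⟩ := exists_eLpNorm_maximalFnAddSelf_rpow_le μ hα ha hP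
  obtain ⟨C₂, hC₂⟩ := exists_eLpNorm_maximalFnAddSelf_rpow_le μ hα hb hQ
  refine ⟨C₁ * C₂, fun v w hv hw hv_top hw_top => ?_⟩
  calc _ ≤ _ := eLpNorm_mul_le_of_inv_eq_add_inv
        ((aemeasurable_maximalFnAddSelf (hv.pow_const α)).pow_const a)
        ((aemeasurable_maximalFnAddSelf (hw.pow_const α)).pow_const b)
        ((ae_maximalFnAddSelf_ne_top hα ha hP hv hv_top).mono fun _ hx =>
          ENNReal.rpow_ne_top_of_nonneg ha.le hx)
        ((ae_maximalFnAddSelf_ne_top hα hb hQ hw hw_top).mono fun _ hx =>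
          ENNReal.rpow_ne_top_of_nonneg hb.le hx) h
    _ ≤ _ := mul_le_mul' (hC₁ v hv) (hC₂ w hw)
    _ = _ := by
        push_cast
        ring

lemma one_lt_mul_ofReal_of_one_lt (hα1 : α ≤ 1) (ha : 0 ≤ a)
    (h : 1 < P * ENNReal.ofReal (α * a)) : 1 < P * ENNReal.ofReal a :=
  h.trans_le (by gcongr; exact mul_le_of_le_one_left ha hα1)

lemma eLpNorm_maximalFn_ne_top (hP : 1 < P) {f : E → ℝ≥0∞} (hf : AEMeasurable f μ)
    (h : eLpNorm f P μ ≠ ∞) : eLpNorm (maximalFn μ f) P μ ≠ ∞ := by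
  obtain ⟨C, hC⟩ := exists_eLpNorm_maximalFn_le μ hP
  exact ne_top_of_le_ne_top (by finiteness) (hC f hf)

lemma exists_eLpNorm_maximalFnAddSelf_maximalFn_rpow_mul_le (hα0 : 0 < α) (hα1 : α ≤ 1)
    (ha : 0 < a) (hb : 0 < b) (hP : 1 < P * ENNReal.ofReal (α * a))
    (hQ : 1 < Q * ENNReal.ofReal b) (h : R⁻¹ = P⁻¹ + Q⁻¹) :
    ∃ C : ℝ≥0, ∀ v w : E → ℝ≥0∞, AEMeasurable v μ → AEMeasurable w μ →
      eLpNorm v (P * ENNReal.ofReal (α * a)) μ ≠ ∞ →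
      eLpNorm w (Q * ENNReal.ofReal (α * b)) μ ≠ ∞ →
      eLpNorm (fun x => maximalFnAddSelf μ (fun z => maximalFn μ v z ^ α) x ^ a *
          maximalFnAddSelf μ (fun z => w z ^ α) x ^ b) R μ ≤
        C * (eLpNorm v (P * ENNReal.ofReal (α * a)) μ ^ (α * a) *
          eLpNorm w (Q * ENNReal.ofReal (α * b)) μ ^ (α * b)) := by
  obtain ⟨C₁, hC₁⟩ := exists_eLpNorm_maximalFnAddSelf_rpow_mul_le (μ := μ) hα0 ha hb
    (one_lt_mul_ofReal_of_one_lt hα1 ha.le hP) hQ h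
  obtain ⟨C₂, hC₂⟩ := exists_eLpNorm_maximalFn_le μ hP
  refine ⟨C₁ * C₂ ^ (α * a), fun v w hv hw hv_top hw_top => ?_⟩
  calc _ ≤ _ := hC₁ _ w measurable_maximalFn.aemeasurable hw
        (eLpNorm_maximalFn_ne_top hP hv hv_top) hw_top
    _ ≤ C₁ * ((C₂ * eLpNorm v (P * ENNReal.ofReal (α * a)) μ) ^ (α * a) *
          eLpNorm w (Q * ENNReal.ofReal (α * b)) μ ^ (α * b)) := by
        gcongr
        exact hC₂ v hv
    _ = _ := by
        have hαa : 0 ≤ α * a := by positivity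
        rw [ENNReal.mul_rpow_of_nonneg _ _ hαa, ENNReal.coe_mul, ENNReal.coe_rpow_of_nonneg _ hαa]
        ring

end MaximalProduct

section WeightedIntegrability

lemma one_add_norm_rpow_neg_le {E : Type*} [SeminormedAddCommGroup E] {a : ℝ} (ha : 0 ≤ a)
    (x z : E) : (1 + ‖z‖) ^ (-a) ≤ (1 + ‖x‖) ^ a * max ‖z - x‖ 1 ^ (-a) := by
  have hmax : max ‖z - x‖ 1 ≤ (1 + ‖x‖) * (1 + ‖z‖) :=
    max_le (by nlinarith [norm_sub_le z x, norm_nonneg x, norm_nonneg z])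
      (one_le_mul_of_one_le_of_one_le (by simp) (by simp))
  calc (1 + ‖z‖) ^ (-a) = (1 + ‖x‖) ^ a * ((1 + ‖x‖) * (1 + ‖z‖)) ^ (-a) := by
        rw [Real.mul_rpow (by positivity) (by positivity), Real.rpow_neg (x := 1 + ‖x‖)
          (by positivity), mul_inv_cancel_left₀ (by positivity)]
    _ ≤ _ := mul_le_mul_of_nonneg_left (Real.rpow_le_rpow_of_nonpos (by positivity) hmax
        (neg_nonpos.2 ha)) (by positivity)

lemma integrable_rpow_mul_of_maximalFn_ne_top {E : Type*} [NormedAddCommGroup E] [NormedSpace ℝ E]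
    [FiniteDimensional ℝ E] [MeasurableSpace E] [BorelSpace E] {μ : Measure E} [μ.IsAddHaarMeasure]
    {σ : ℝ} (hσ : 0 < σ) {f : E → ℂ} (hf : AEStronglyMeasurable f μ) {x : E}
    (h : maximalFn μ (‖f ·‖ₑ) x ≠ ∞) :
    Integrable (fun z => (((1 + ‖z‖) ^ (-(finrank ℝ E + σ)) : ℝ) : ℂ) * f z) μ := by
  obtain ⟨C, hC⟩ := exists_lintegral_mul_max_rpow_le μ hσ
  refine ⟨.mul (Measurable.aestronglyMeasurable (by fun_prop)) hf, ?_⟩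
  calc ∫⁻ z, ‖(((1 + ‖z‖) ^ (-(finrank ℝ E + σ)) : ℝ) : ℂ) * f z‖ₑ ∂μ
      ≤ ∫⁻ z, ENNReal.ofReal ((1 + ‖x‖) ^ (finrank ℝ E + σ)) *
        (‖f z‖ₑ * ENNReal.ofReal (max ‖z - x‖ 1 ^ (-(finrank ℝ E + σ)))) ∂μ := by
        refine lintegral_mono fun z => ?_
        rw [enorm_mul, enorm_ofReal_of_nonneg (by positivity), mul_comm, mul_left_comm,
          ← ENNReal.ofReal_mul (by positivity)]
        gcongr
        exact one_add_norm_rpow_neg_le (by positivity) x z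
    _ ≤ ENNReal.ofReal ((1 + ‖x‖) ^ (finrank ℝ E + σ)) *
        (C * ENNReal.ofReal (1 ^ (-σ)) * maximalFn μ (‖f ·‖ₑ) x) := by
        rw [lintegral_const_mul' _ _ ENNReal.ofReal_ne_top]
        gcongr
        exact hC _ hf.enorm x 1 one_pos
    _ < ∞ := by finiteness

end WeightedIntegrability

section Composition

variable {α : ℝ} {K : ℝ≥0} {F : ℂ → ℂ}

lemma enorm_sub_le_of_holderWith {X Y : Type*} [SeminormedAddCommGroup X]
    [SeminormedAddCommGroup Y] {F : X → Y} (hα : 0 ≤ α) (hF : HolderWith K α.toNNReal F)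
    (z w : X) : ‖F z - F w‖ₑ ≤ K * ‖z - w‖ₑ ^ α := by
  simpa only [edist_eq_enorm_sub, Real.coe_toNNReal α hα] using hF z w

variable {n : ℕ} {σ s : ℝ} {u : EuclideanSpace ℝ (Fin n) → ℂ}

lemma integrable_rpow_mul_comp_of_holderWith (hα : 0 < α) (hσ : 0 < σ)
    (hF : HolderWith K α.toNNReal F) (hu : AEStronglyMeasurable u volume)
    {x : EuclideanSpace ℝ (Fin n)} (h : maximalFn volume (fun z => ‖u z‖ₑ ^ α) x ≠ ∞) :
    Integrable (fun z => (((1 + ‖z‖) ^ (-(n + σ) : ℝ) : ℝ) : ℂ) * F (u z)) volume := by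
  have hFc : Continuous F := hF.continuous (Real.toNNReal_pos.2 hα)
  have hle (z) : ‖F (u z)‖ₑ ≤ K * ‖u z‖ₑ ^ α + ‖F 0‖ₑ := by
    rw [← sub_add_cancel (F (u z)) (F 0)]
    refine (enorm_add_le _ _).trans (add_le_add_left ?_ _)
    simpa only [sub_zero] using enorm_sub_le_of_holderWith hα.le hF (u z) 0
  have hmax := maximalFn_le_add_const (μ := volume) (x := x) hle
  rw [maximalFn_const_mul ENNReal.coe_ne_top] at hmax
  simpa only [finrank_euclideanSpace_fin] using integrable_rpow_mul_of_maximalFn_ne_top hσ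
    (hFc.comp_aestronglyMeasurable hu) (ne_top_of_le_ne_top (by finiteness) hmax)

lemma incrementIntegral_eq_lintegral_sub (f : EuclideanSpace ℝ (Fin n) → ℂ)
    (x : EuclideanSpace ℝ (Fin n)) : incrementIntegral σ f x =
      ∫⁻ z, ‖f z - f x‖ₑ * ENNReal.ofReal (‖z - x‖ ^ (-(n + σ) : ℝ)) := by
  simpa only [incrementIntegral, add_sub_cancel_left] using lintegral_add_left_eq_self
    (fun z => ‖f z - f x‖ₑ * ENNReal.ofReal (‖z - x‖ ^ (-(n + σ) : ℝ))) x

lemma exists_enorm_comp_sub_le_maximalFn (n : ℕ) (hα0 : 0 < α) (hα1 : α ≤ 1) (hs0 : 0 < s)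
    (hs1 : s < 1) :
    ∃ C : ℝ≥0, ∀ (K : ℝ≥0) (F : ℂ → ℂ), HolderWith K α.toNNReal F →
      ∀ u g : EuclideanSpace ℝ (Fin n) → ℂ, HasFracDeriv s u g → AEStronglyMeasurable g volume →
      ∀ x y, IsLebesguePoint volume u x → IsLebesguePoint volume u y →
        ‖F (u x) - F (u y)‖ₑ ≤ C * K * (ENNReal.ofReal (‖x - y‖ ^ (α * s)) *
          (maximalFn volume (‖g ·‖ₑ) x ^ α + maximalFn volume (‖g ·‖ₑ) y ^ α)) := by
  obtain ⟨C, hC⟩ := exists_enorm_sub_le_maximalFn n hs0 hs1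
  refine ⟨C ^ α, fun K F hF u g hug hg x y hx hy => ?_⟩
  calc ‖F (u x) - F (u y)‖ₑ ≤ K * ‖u x - u y‖ₑ ^ α := enorm_sub_le_of_holderWith hα0.le hF _ _
    _ ≤ K * (C * ENNReal.ofReal (‖x - y‖ ^ s) *
        (maximalFn volume (‖g ·‖ₑ) x + maximalFn volume (‖g ·‖ₑ) y)) ^ α := by
      gcongr
      exact hC u g hug hg x y hx hy
    _ = (C ^ α : ℝ≥0) * K * (ENNReal.ofReal (‖x - y‖ ^ (α * s)) *
        (maximalFn volume (‖g ·‖ₑ) x + maximalFn volume (‖g ·‖ₑ) y) ^ α) := by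
      rw [ENNReal.mul_rpow_of_nonneg _ _ hα0.le, ENNReal.mul_rpow_of_nonneg _ _ hα0.le,
        ← ENNReal.coe_rpow_of_nonneg _ hα0.le, mul_comm α,
        ENNReal.ofReal_rpow_of_nonneg (by positivity) hα0.le, ← Real.rpow_mul (norm_nonneg _)]
      ring
    _ ≤ _ := by
      gcongr
      exact ENNReal.rpow_add_le_add_rpow _ _ hα0.le hα1

lemma exists_incrementIntegral_comp_le [NeZero n] (hα0 : 0 < α) (hα1 : α ≤ 1) (hσ : 0 < σ)
    (hσs : σ < α * s) (hs : s < 1) :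
    ∃ C : ℝ≥0, ∀ (K : ℝ≥0) (F : ℂ → ℂ), HolderWith K α.toNNReal F →
      ∀ u g : EuclideanSpace ℝ (Fin n) → ℂ, HasFracDeriv s u g → AEStronglyMeasurable g volume →
      ∀ᵐ x, maximalFnAddSelf volume (fun z => maximalFn volume (‖g ·‖ₑ) z ^ α) x ≠ ∞ →
        maximalFnAddSelf volume (fun z => ‖u z‖ₑ ^ α) x ≠ ∞ →
        incrementIntegral σ (fun z => F (u z)) x ≤ C * K *
          (maximalFnAddSelf volume (fun z => maximalFn volume (‖g ·‖ₑ) z ^ α) x ^ (σ / (α * s)) *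
            maximalFnAddSelf volume (fun z => ‖u z‖ₑ ^ α) x ^ (1 - σ / (α * s))) := by
  obtain ⟨C₁, hC₁⟩ := exists_enorm_comp_sub_le_maximalFn n hα0 hα1
    (pos_of_mul_pos_right (hσ.trans hσs) hα0.le) hs
  obtain ⟨C₂, hC₂⟩ := exists_lintegral_mul_norm_sub_rpow_le_maximalFnAddSelf
    (volume : Measure (EuclideanSpace ℝ (Fin n))) hσ hσs
  refine ⟨C₂ * (C₁ + 1), fun K F hF u g hug hg => ?_⟩
  have hu := locallyIntegrable_of_integrable_rpow_mul hug.1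
  have hG := (measurable_maximalFn (μ := volume) (f := (‖g ·‖ₑ))).pow_const α
  have hleb := ae_isLebesguePoint hu
  filter_upwards [hleb] with x hx hGx hUx
  rw [incrementIntegral_eq_lintegral_sub]
  have hbound := hC₂ (fun z => ‖F (u z) - F (u x)‖ₑ) _ _ ((C₁ + 1) * K) hG.aemeasurable
    (hu.aestronglyMeasurable.enorm.pow_const α) x ?_ (.of_forall fun z => ?_) hGx hUx
  · rw [finrank_euclideanSpace_fin] at hbound
    exact hbound.trans_eq (by push_cast; ring)
  · filter_upwards [hleb] with z hz
    refine (hC₁ K F hF u g hug hg z x hz hx).trans ?_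
    push_cast
    gcongr
    exact le_self_add
  · calc ‖F (u z) - F (u x)‖ₑ ≤ K * ‖u z - u x‖ₑ ^ α := enorm_sub_le_of_holderWith hα0.le hF _ _
      _ ≤ ((C₁ + 1) * K : ℝ≥0) * (‖u z‖ₑ ^ α + ‖u x‖ₑ ^ α) := by
        gcongr
        · exact le_mul_of_one_le_left' le_add_self
        · exact (ENNReal.rpow_le_rpow enorm_sub_le hα0.le).trans
            (ENNReal.rpow_add_le_add_rpow _ _ hα0.le hα1)

end Composition

section FracDeriv

variable {n : ℕ} {σ : ℝ} {P : ℝ≥0∞} {f : EuclideanSpace ℝ (Fin n) → ℂ}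

lemma lintegral_mul_enorm_schwartz_ne_top {D : EuclideanSpace ℝ (Fin n) → ℝ≥0∞} (hP : 1 ≤ P)
    (hD : AEMeasurable D volume) (h : eLpNorm D P volume ≠ ∞)
    (φ : 𝓢(EuclideanSpace ℝ (Fin n), ℂ)) : ∫⁻ x, D x * ‖φ x‖ₑ ≠ ∞ := by
  have hinv : (1 : ℝ≥0∞)⁻¹ = P⁻¹ + (1 - P⁻¹)⁻¹⁻¹ := by
    rw [inv_inv, inv_one, add_tsub_cancel_of_le (ENNReal.inv_le_one.2 hP)]
  have hhold := eLpNorm_mul_le_of_inv_eq_add_inv hD φ.continuous.enorm.aemeasurable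
    (ae_ne_top_of_eLpNorm_ne_top hD (one_pos.trans_le hP).ne' h)
    (.of_forall fun _ => enorm_ne_top) hinv
  simp only [eLpNorm_one_eq_lintegral_enorm, enorm_eq_self, eLpNorm_enorm] at hhold
  exact ne_top_of_le_ne_top (ENNReal.mul_ne_top h (φ.memLp _ volume).2.ne) hhold

lemma aemeasurable_incrementIntegral (hf : AEStronglyMeasurable f volume) :
    AEMeasurable (incrementIntegral σ f) volume := by
  rw [funext incrementIntegral_eq_lintegral_enorm]
  exact (aestronglyMeasurable_increment_mul hf).enorm.lintegral_prod_right'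

lemma exists_hasFracDeriv_of_eLpNorm_incrementIntegral_ne_top [NeZero n] (hσ0 : 0 < σ)
    (hσ1 : σ < 1) (hP : 1 ≤ P) :
    ∃ C : ℝ≥0, ∀ f : EuclideanSpace ℝ (Fin n) → ℂ,
      Integrable (fun x => (((1 + ‖x‖) ^ (-(n + σ) : ℝ) : ℝ) : ℂ) * f x) volume →
      eLpNorm (incrementIntegral σ f) P volume ≠ ∞ →
      ∃ h, HasFracDeriv σ f h ∧ MemLp h P volume ∧
        eLpNorm h P volume ≤ C * eLpNorm (incrementIntegral σ f) P volume := by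
  obtain ⟨c, hc⟩ := exists_hasFracDeriv_singularIntegral (n := n) hσ0 hσ1
  refine ⟨‖c‖₊, fun f hf hfin => ?_⟩
  have hfm := (locallyIntegrable_of_integrable_rpow_mul hf).aestronglyMeasurable
  set h := fun x => c * ∫ y, (f (x + y) - f x) * ((‖y‖ ^ (-(n + σ) : ℝ) : ℝ) : ℂ)
  have hle : eLpNorm h P volume ≤ ‖c‖₊ * eLpNorm (incrementIntegral σ f) P volume := by
    refine eLpNorm_le_nnreal_smul_eLpNorm_of_ae_le_mul' (.of_forall fun x => ?_) P
    rw [enorm_mul, enorm_eq_self, incrementIntegral_eq_lintegral_enorm, enorm_eq_nnnorm c]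
    gcongr
    exact enorm_integral_le_lintegral_enorm _
  exact ⟨h, hc f hf (lintegral_mul_enorm_schwartz_ne_top hP (aemeasurable_incrementIntegral hfm)
    hfin), ⟨(aestronglyMeasurable_increment_mul hfm).integral_prod_right'.const_mul c,
    hle.trans_lt (by finiteness)⟩, hle⟩

end FracDeriv

section FracChainRule

variable {n : ℕ} {α σ s : ℝ} {p p₁ p₂ : ℝ≥0∞}

lemma eLpNorm_ne_top_of_memLp_norm_rpow {X Y : Type*} [MeasurableSpace X] {μ : Measure X}
    [NormedAddCommGroup Y] {u : X → Y} {θ : ℝ} (hθ : 0 < θ)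
    (h : MemLp (fun x => ‖u x‖ ^ θ) p μ) : eLpNorm u (p * ENNReal.ofReal θ) μ ≠ ∞ := by
  have hfin := h.2.ne
  rwa [eLpNorm_norm_rpow u hθ, Ne, ENNReal.rpow_eq_top_iff_of_pos hθ] at hfin

lemma integrable_rpow_mul_comp_of_eLpNorm_ne_top [NeZero n] {b : ℝ} (hα : 0 < α) (hσ : 0 < σ)
    (hb : 0 < b) (hp : 1 < p * ENNReal.ofReal b) {K : ℝ≥0} {F : ℂ → ℂ}
    (hF : HolderWith K α.toNNReal F) {u : EuclideanSpace ℝ (Fin n) → ℂ}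
    (hu : AEStronglyMeasurable u volume)
    (hu_top : eLpNorm u (p * ENNReal.ofReal (α * b)) volume ≠ ∞) :
    Integrable (fun x => (((1 + ‖x‖) ^ (-(n + σ) : ℝ) : ℝ) : ℂ) * F (u x)) volume := by
  rw [← eLpNorm_enorm] at hu_top
  obtain ⟨x, hx⟩ := (ae_maximalFnAddSelf_ne_top hα hb hp hu.enorm hu_top).exists
  exact integrable_rpow_mul_comp_of_holderWith hα hσ hF hu (ne_top_of_le_ne_top hx le_self_add)

lemma exists_eLpNorm_incrementIntegral_comp_le [NeZero n] (hα0 : 0 < α) (hα1 : α ≤ 1) (hσ : 0 < σ)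
    (hσs : σ < α * s) (hs : s < 1) (hpp : p⁻¹ = p₁⁻¹ + p₂⁻¹)
    (hp₁ : 1 < p₁ * ENNReal.ofReal (1 - σ / (α * s))) (hp₂ : 1 < p₂ * ENNReal.ofReal (σ / s)) :
    ∃ C : ℝ≥0, ∀ (K : ℝ≥0) (F : ℂ → ℂ), HolderWith K α.toNNReal F →
      ∀ u g : EuclideanSpace ℝ (Fin n) → ℂ, HasFracDeriv s u g →
      eLpNorm u (p₁ * ENNReal.ofReal (α - σ / s)) volume ≠ ∞ →
      MemLp g (p₂ * ENNReal.ofReal (σ / s)) volume →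
      eLpNorm (incrementIntegral σ fun x => F (u x)) p volume ≤
        C * K * eLpNorm u (p₁ * ENNReal.ofReal (α - σ / s)) volume ^ (α - σ / s) *
          eLpNorm g (p₂ * ENNReal.ofReal (σ / s)) volume ^ (σ / s) := by
  have ha : 0 < σ / (α * s) := div_pos hσ (hσ.trans hσs)
  have hb : 0 < 1 - σ / (α * s) := sub_pos.2 ((div_lt_one (hσ.trans hσs)).2 hσs)
  have hαa : σ / s = α * (σ / (α * s)) := by field_simp
  have hαb : α - σ / s = α * (1 - σ / (α * s)) := by rw [mul_sub, ← hαa, mul_one]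
  rw [hαa] at hp₂
  rw [hαb, hαa]
  obtain ⟨C₁, hC₁⟩ := exists_incrementIntegral_comp_le (n := n) hα0 hα1 hσ hσs hs
  obtain ⟨C₂, hC₂⟩ := exists_eLpNorm_maximalFnAddSelf_maximalFn_rpow_mul_le (R := p)
    (μ := (volume : Measure (EuclideanSpace ℝ (Fin n)))) hα0 hα1 ha hb hp₂ hp₁
    (by rw [hpp, add_comm])
  refine ⟨C₁ * C₂, fun K F hF u g hug hu hg => ?_⟩
  have hum := (locallyIntegrable_of_integrable_rpow_mul hug.1).aestronglyMeasurable.enorm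
  rw [← eLpNorm_enorm] at hu
  have hgm := hg.1.enorm
  have hg' := hg.2.ne
  rw [← eLpNorm_enorm] at hg'
  have hincr : ∀ᵐ x, incrementIntegral σ (fun z => F (u z)) x ≤ (C₁ * K : ℝ≥0) *
      (maximalFnAddSelf volume (fun z => maximalFn volume (‖g ·‖ₑ) z ^ α) x ^ (σ / (α * s)) *
        maximalFnAddSelf volume (fun z => ‖u z‖ₑ ^ α) x ^ (1 - σ / (α * s))) := by
    filter_upwards [hC₁ K F hF u g hug hg.1,
      ae_maximalFnAddSelf_ne_top hα0 ha (one_lt_mul_ofReal_of_one_lt hα1 ha.le hp₂)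
        measurable_maximalFn.aemeasurable (eLpNorm_maximalFn_ne_top hp₂ hgm hg'),
      ae_maximalFnAddSelf_ne_top hα0 hb hp₁ hum hu] with x hx hgx hux
    exact (hx hgx hux).trans_eq (by rw [ENNReal.coe_mul])
  calc _ ≤ _ := eLpNorm_le_mul_of_ae_le_mul hincr
    _ ≤ _ := mul_le_mul_right (hC₂ _ _ hgm hum hg' hu) _
    _ = _ := by
        rw [eLpNorm_enorm, eLpNorm_enorm]
        push_cast
        ring

end FracChainRule

theorem propositionA1_general (n : ℕ) (hn : 1 ≤ n) (α σ s : ℝ) (p p₁ p₂ : ℝ≥0∞)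
    (hα0 : 0 < α) (hα1 : α ≤ 1) (hσ0 : 0 < σ) (hs0 : σ / α < s) (hs1 : s < 1)
    (hpp : p⁻¹ = p₁⁻¹ + p₂⁻¹)
    (hp₁ : 1 < ENNReal.ofReal (1 - σ / (α * s)) * p₁)
    (hp₂ : 1 < ENNReal.ofReal (σ / s) * p₂) :
    ∃ C : ℝ≥0, ∀ (K : ℝ≥0) (F : ℂ → ℂ), HolderWith K α.toNNReal F →
      ∀ u g : EuclideanSpace ℝ (Fin n) → ℂ,
        MemLp (fun x => ‖u x‖ ^ (α - σ / s)) p₁ volume →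
        HasFracDeriv s u g →
        MemLp g (ENNReal.ofReal (σ / s) * p₂) volume →
        ∃ h : EuclideanSpace ℝ (Fin n) → ℂ,
          HasFracDeriv σ (fun x => F (u x)) h ∧
          MemLp h p volume ∧
          eLpNorm h p volume ≤
            C * K * eLpNorm (fun x => ‖u x‖ ^ (α - σ / s)) p₁ volume *
              eLpNorm g (ENNReal.ofReal (σ / s) * p₂) volume ^ (σ / s) := by
  have : NeZero n := ⟨by lia⟩
  have hσs : σ < α * s := (div_lt_iff₀' hα0).1 hs0
  have hs : 0 < s := (div_pos hσ0 hα0).trans hs0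
  have ha : 0 < σ / (α * s) := div_pos hσ0 (hσ0.trans hσs)
  have hb : 0 < 1 - σ / (α * s) := sub_pos.2 ((div_lt_one (hσ0.trans hσs)).2 hσs)
  have hαa : σ / s = α * (σ / (α * s)) := by field_simp
  have hαb : α - σ / s = α * (1 - σ / (α * s)) := by rw [mul_sub, ← hαa, mul_one]
  simp only [mul_comm (ENNReal.ofReal _)] at hp₁ hp₂ ⊢
  have hp := one_le_of_inv_eq_add_inv hpp (sub_add_cancel _ _) hb.le ha.le hp₁
    (one_lt_mul_ofReal_of_one_lt hα1 ha.le (hαa ▸ hp₂))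
  obtain ⟨C₁, hC₁⟩ := exists_eLpNorm_incrementIntegral_comp_le (n := n) hα0 hα1 hσ0 hσs hs1 hpp
    hp₁ hp₂
  obtain ⟨C₂, hC₂⟩ := exists_hasFracDeriv_of_eLpNorm_incrementIntegral_ne_top (n := n) (P := p)
    hσ0 (hσs.trans (mul_lt_one_of_nonneg_of_lt_one_right hα1 hs.le hs1)) hp
  refine ⟨C₂ * C₁, fun K F hF u g hu hug hg => ?_⟩
  have hθ : 0 < α - σ / s := hαb ▸ mul_pos hα0 hb
  have hu_top := eLpNorm_ne_top_of_memLp_norm_rpow hθ hu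
  have hle := hC₁ K F hF u g hug hu_top hg
  rw [← eLpNorm_norm_rpow u hθ] at hle
  obtain ⟨h, hh, hhp, hhle⟩ := hC₂ _ (integrable_rpow_mul_comp_of_eLpNorm_ne_top hα0 hσ0 hb hp₁ hF
    (locallyIntegrable_of_integrable_rpow_mul hug.1).aestronglyMeasurable (hαb ▸ hu_top))
    (ne_top_of_le_ne_top (by finiteness) hle)
  refine ⟨h, hh, hhp, (hhle.trans (mul_le_mul_right hle _)).trans_eq ?_⟩
  push_cast
  ring

theorem propositionA1 (n : ℕ) (hn : 1 ≤ n) (α σ s p p₂ : ℝ) (p₁ : ℝ≥0∞)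
    (hα0 : 0 < α) (hα1 : α < 1) (hσ0 : 0 < σ) (hσα : σ < α)
    (hs0 : σ / α < s) (hs1 : s < 1) (hp : 1 < p)
    (hpp : (ENNReal.ofReal p)⁻¹ = p₁⁻¹ + (ENNReal.ofReal p₂)⁻¹)
    (hp₁ : 1 < ENNReal.ofReal (1 - σ / (α * s)) * p₁)
    (hp₂ : 1 < σ / s * p₂) :
    ∃ C : ℝ≥0, ∀ (K : ℝ≥0) (F : ℂ → ℂ), HolderWith K α.toNNReal F →
      ∀ u g : EuclideanSpace ℝ (Fin n) → ℂ,
        MemLp (fun x => ‖u x‖ ^ (α - σ / s)) p₁ volume →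
        HasFracDeriv s u g →
        MemLp g (ENNReal.ofReal (σ / s * p₂)) volume →
        ∃ h : EuclideanSpace ℝ (Fin n) → ℂ,
          HasFracDeriv σ (fun x => F (u x)) h ∧
          MemLp h (ENNReal.ofReal p) volume ∧
          eLpNorm h (ENNReal.ofReal p) volume ≤
            C * K * eLpNorm (fun x => ‖u x‖ ^ (α - σ / s)) p₁ volume *
              eLpNorm g (ENNReal.ofReal (σ / s * p₂)) volume ^ (σ / s) := by
  have hq := ENNReal.ofReal_mul (q := p₂) (div_pos hσ0 ((div_pos hσ0 hα0).trans hs0)).le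
  exact hq ▸ propositionA1_general n hn α σ s _ p₁ _ hα0 hα1.le hσ0 hs0 hs1 hpp hp₁
    (hq ▸ ENNReal.one_lt_ofReal.2 hp₂)
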